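/- Lemma (Robust contraction and link to $\mathcal L_p$ stability and ISS). Let $f:\mathbb R^n\times[0,\infty)\to\mathbb R^n$ and $\Theta:\mathbb R^n\times[0,\infty)\to\mathbb R^{n\times n}$ be continuously differentiable, put $M=\Theta^{T}\Theta$, and suppose that $\dot x=f(x,t)$ is contracting at rate $\lambda>0$ in the uniformly positive definite metric $M$: there is $m>0$ (written $\lambda_{\min}(M)$) with $M(x,t)\ge mI$ for all $x$ and $t\ge 0$, and the symmetric part of the generalized Jacobian $F=\bigl(\dot\Theta+\Theta\,\partial f/\partial x\bigr)\Theta^{-1}$, where $\dot\Theta=\partial_t\Theta+(\partial_x\Theta)f$, satisfies $F\le-\lambda I$. For a smooth matrix field $W$ write $\int_x^y\|W\delta x\|$ for the infimum of $\int_0^1\|W(\gamma(s))\gamma'(s)\|\,ds$ over all $C^1$ paths $\gamma$ from $x$ to $y$ (the smallest path integral). All norms are Euclidean. A trajectory of $\dot x=g(x,t)$ is a function with $g(x(s),s)$ locally integrable in $s$ and $x(t)=x(t_0)+\int_{t_0}^t g(x(s),s)\,ds$ for $t\ge t_0$. Let $d:\mathbb R^n\times[0,\infty)\to\mathbb R^n$,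 let $P_1$ be a trajectory of $\dot x=f(x,t)$ and $P_2$ a trajectory of the perturbed system $\dot x=f(x,t)+d(x,t)$, both on $[0,\infty)$. Put $R(t)=\int_{P_1(t)}^{P_2(t)}\|\Theta(x,t)\delta x\|$, and write $d(t)=d(P_2(t),t)$ and $(\Theta d)(t)=\Theta(P_2(t),t)\,d(P_2(t),t)$. 1. For all $t\ge0$, $R(t)\le e^{-\lambda t}R(0)+\int_0^t e^{-\lambda(t-\tau)}\|(\Theta d)(\tau)\|\,d\tau$, the integrand being integrable. 2. If $\|(\Theta d)(t)\|\le D$ for almost all $t\ge0$, then $R(t)\le e^{-\lambda t}R(0)+\frac{D}{\lambda}(1-e^{-\lambda t})$ for all $t\ge 0$, and $\limsup_{t\to\infty}R(t)\le D/\lambda$. In particular, if $\Theta d$ is bounded on $\mathbb R^n\times[0,\infty)$, then $\limsup_{t\to\infty}R(t)\le\sup_{x,t}\|\Theta(x,t)d(x,t)\|/\lambda$. 3. (Finite-gain $\mathcal L_p$ stability.) Let $y=h(x,d,t)\in\mathbb R^k$ be an output, $Y_1(t)=h(P_1(t),0,t)$, $Y_2(t)=h(P_2(t),d(t),t)$,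 and suppose that $\int_{Y_1}^{Y_2}\|\delta y\|\le\eta_1\int_{P_1}^{P_2}\|\delta x\|+\eta_2\|d(t)\|$ for all $t\ge0$, with constants $\eta_1,\eta_2\ge0$. Let $p\in[1,\infty]$, let $\|(u)_\tau\|_{\mathcal L_p}$ be the $L^p$ norm of $u$ on $[0,\tau]$, and assume that $d(t)$ has finite $\|(d)_\tau\|_{\mathcal L_p}$ for all $\tau\ge 0$. Then for all $\tau\in[0,\infty)$, $\|(\Theta d)_\tau\|_{\mathcal L_p}<\infty$ and $$\Bigl\|\Bigl(\int_{Y_1}^{Y_2}\|\delta y\|\Bigr)_\tau\Bigr\|_{\mathcal L_p}\le\frac{\eta_1\zeta R(0)}{\sqrt m}+\Bigl(\frac{\eta_1}{\lambda}+\eta_2\Bigr)\frac{\|(\Theta d)_\tau\|_{\mathcal L_p}}{\sqrt m},$$ where $\zeta=1$ if $p=\infty$ and $\zeta=1/(\lambda p)^{1/p}$ if $p<\infty$. For $p=\infty$ the inequality holds both with essential suprema and with suprema over $[0,\tau]$. If moreover $M\le\overline m I$ uniformly, then for every $p$ the bound holds with $\sqrt{\overline m}\,\|(d)_\tau\|_{\mathcal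 L_p}$ in place of $\|(\Theta d)_\tau\|_{\mathcal L_p}$. 4. (Input-to-state stability.) Let $t_0\ge0$ and let $P_1$ be a trajectory of $\dot x=f(x,t)$ on $[t_0,\infty)$. For a weight $W(x,t)$ and a distance $\rho_t(x,y)$, the perturbed system is called ISS about $P_1$ with comparison functions $\beta\in\mathcal{KL}$, $\gamma\in\mathcal K$ if (a) for every $d$ that is continuous on $\mathbb R^n\times[t_0,\infty)$, Lipschitz in $x$ on bounded sets uniformly for $t$ in compact intervals, and with $Wd$ bounded, there is through every $x_0$ a trajectory of $\dot x=f+d$ on $[t_0,\infty)$ with value $x_0$ at $t_0$; and (b) for every $d$ and every trajectory $P_2$ of $\dot x=f+d$ on $[t_0,\infty)$, for all $t\ge t_0$, $$\rho_t(P_1(t),P_2(t))\le\beta\bigl(\rho_{t_0}(P_1(t_0),P_2(t_0)),t-t_0\bigr)+\gamma\Bigl(\sup_{t_0\le\tau\le t}\|W(P_2(\tau),\tau)d(P_2(\tau),\tau)\|\Bigr)$$ whenever the supremum is finite. Then the perturbed system is ISS about $P_1$ in each of the following senses: (i) $\rho_t(x,y)=\int_x^y\|\Theta(\cdot,t)\delta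 x\|$ and $W=\Theta$, with $\beta,\gamma$ independent of $t_0$ and $P_1$; (ii) $\rho_t(x,y)=\|y-x\|$ and $W=\Theta$, with $\beta,\gamma$ that may depend on $t_0$ and $P_1$; (iii) if $M\le\overline mI$ uniformly, $\rho_t(x,y)=\|y-x\|$ and $W=I$, with $\beta,\gamma$ independent of $t_0$ and $P_1$. -/

import Mathlib

open MeasureTheory Set Filter Topology
open scoped ENNReal

noncomputable section

section Contraction

variable {E : Type*} [NormedAddCommGroup E] [InnerProductSpace ℝ E]

/-- `x` is a trajectory on `[t₀, ∞)` of `ẋ = g(x, t)` in the sense of Carathéodory: it is the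
integral of its (locally integrable) velocity. When `t ↦ g (x t) t` is continuous this is the same
as being a continuously differentiable solution. -/
def IsTrajectory (g : E → ℝ → E) (t₀ : ℝ) (x : ℝ → E) : Prop :=
  ∀ t, t₀ ≤ t → IntervalIntegrable (fun s => g (x s) s) volume t₀ t ∧
    x t = x t₀ + ∫ s in t₀..t, g (x s) s

/-- The path integral `∫_γ ‖W(x) δx‖` over a path `γ : [0, 1] → E`. -/
def pathLength (W : E → E →L[ℝ] E) (γ : ℝ → E) : ℝ :=
  ∫ s in (0 : ℝ)..1, ‖W (γ s) (derivWithin γ (Icc 0 1) s)‖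

/-- The smallest path integral `∫_x^y ‖W δx‖`: the infimum of the path integrals over all
continuously differentiable paths from `x` to `y`. -/
def pathDist (W : E → E →L[ℝ] E) (x y : E) : ℝ :=
  sInf {L : ℝ | ∃ γ : ℝ → E, ContDiffOn ℝ 1 γ (Icc 0 1) ∧ γ 0 = x ∧ γ 1 = y ∧
    L = pathLength W γ}

/-- The Euclidean smallest path integral `∫_x^y ‖δx‖`. -/
def euclidPathDist (x y : E) : ℝ :=
  pathDist (fun _ => ContinuousLinearMap.id ℝ E) x y

/-- The derivative `Θ̇ = ∂Θ/∂t + (∂Θ/∂x) f` of `Θ` along `ẋ = f(x, t)`, for times `t ≥ 0`. -/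
def derivAlong (f : E → ℝ → E) (Θ : E → ℝ → E →L[ℝ] E) (x : E) (t : ℝ) : E →L[ℝ] E :=
  derivWithin (fun s => Θ x s) (Ici 0) t + fderiv ℝ (fun y => Θ y t) x (f x t)

/-- The generalized Jacobian `F = (Θ̇ + Θ ∂f/∂x) Θ⁻¹`. -/
def generalizedJacobian (f : E → ℝ → E) (Θ : E → ℝ → E →L[ℝ] E) (x : E) (t : ℝ) : E →L[ℝ] E :=
  (derivAlong f Θ x t + (Θ x t).comp (fderiv ℝ (fun y => f y t) x)).comp (Θ x t).inverse

/-- The metric `M = Θᵀ Θ`. -/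
def metricTensor [CompleteSpace E] (Θ : E → ℝ → E →L[ℝ] E) (x : E) (t : ℝ) : E →L[ℝ] E :=
  (ContinuousLinearMap.adjoint (Θ x t)).comp (Θ x t)

/-- `ẋ = f(x, t)`, `t ≥ 0`, is contracting at rate `lam` in the metric `M = Θᵀ Θ`, which is
uniformly positive definite with lower bound `m`: `M ≥ m I` and `F ≤ -lam I`, the latter meaning
as usual that the symmetric part of `F` is at most `-lam I`. -/
structure IsContracting [CompleteSpace E] (f : E → ℝ → E) (Θ : E → ℝ → E →L[ℝ] E)
    (lam m : ℝ) : Prop where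
  rate_pos : 0 < lam
  lower_pos : 0 < m
  contDiffOn_field : ContDiffOn ℝ 1 (Function.uncurry f) (univ ×ˢ Ici 0)
  contDiffOn_factor : ContDiffOn ℝ 1 (Function.uncurry Θ) (univ ×ˢ Ici 0)
  metric_lower : ∀ x t, 0 ≤ t → ∀ v, m * ‖v‖ ^ 2 ≤ inner ℝ v (metricTensor Θ x t v)
  jacobian_upper : ∀ x t, 0 ≤ t → ∀ w,
    inner ℝ w (generalizedJacobian f Θ x t w) ≤ -lam * ‖w‖ ^ 2

/-- Comparison functions of class `𝒦`. -/
structure IsClassK (α : ℝ → ℝ) : Prop where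
  continuousOn : ContinuousOn α (Ici 0)
  strictMonoOn : StrictMonoOn α (Ici 0)
  map_zero : α 0 = 0

/-- Comparison functions of class `𝒦ℒ`. -/
structure IsClassKL (β : ℝ → ℝ → ℝ) : Prop where
  classK : ∀ s, 0 ≤ s → IsClassK (fun r => β r s)
  antitoneOn : ∀ r, 0 ≤ r → AntitoneOn (β r) (Ici 0)
  tendsto_zero : ∀ r, 0 ≤ r → Tendsto (β r) atTop (𝓝 0)

/-- Input-to-state stability of `ẋ = f(x, t) + d(x, t)` about the nominal trajectory `P₁`, from the
initial time `t₀`, with comparison functions `β` and `γ`. The deviation of states at time `t` is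
measured by `ρ t`, and the disturbance by `‖W(x, t) d(x, t)‖`. For every bounded disturbance for
which the initial value problem is well posed, trajectories exist for all times; and whatever the
disturbance is, every trajectory `P₂` satisfies
`ρ(P₁(t), P₂(t)) ≤ β(ρ(P₁(t₀), P₂(t₀)), t - t₀) + γ(sup_{t₀ ≤ τ ≤ t} ‖W d‖)`. -/
def IsISSAbout (f : E → ℝ → E) (W : E → ℝ → E →L[ℝ] E) (ρ : ℝ → E → E → ℝ)
    (β : ℝ → ℝ → ℝ) (γ : ℝ → ℝ) (t₀ : ℝ) (P₁ : ℝ → E) : Prop :=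
  ∀ d : E → ℝ → E,
    (ContinuousOn (Function.uncurry d) (univ ×ˢ Ici t₀) →
      (∀ r T : ℝ, ∃ K, ∀ t ∈ Icc t₀ T, LipschitzOnWith K (fun x => d x t) (Metric.ball 0 r)) →
      (∃ D, ∀ x t, t₀ ≤ t → ‖W x t (d x t)‖ ≤ D) →
      ∀ x₀ : E, ∃ P₂ : ℝ → E, P₂ t₀ = x₀ ∧ IsTrajectory (fun x t => f x t + d x t) t₀ P₂) ∧
    (∀ P₂ : ℝ → E, IsTrajectory (fun x t => f x t + d x t) t₀ P₂ →
      ∀ t D : ℝ, t₀ ≤ t → (∀ τ ∈ Icc t₀ t, ‖W (P₂ τ) τ (d (P₂ τ) τ)‖ ≤ D) →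
        ρ t (P₁ t) (P₂ t) ≤ β (ρ t₀ (P₁ t₀) (P₂ t₀)) (t - t₀) + γ D)

end Contraction

/-- The constant `ζ`: the bound for the `ℒ_p` norm of `t ↦ exp (-lam t)`. -/
def zetaConst (lam : ℝ) (p : ℝ≥0∞) : ℝ :=
  if p = ∞ then 1 else 1 / (lam * p.toReal) ^ (1 / p.toReal)

end

/-! ### The smallest path integral as a distance: triangle inequality and comparison with the norm
-/

section PathDist

variable {E : Type*} [NormedAddCommGroup E] [InnerProductSpace ℝ E]

/-! Formally, `Θ δx` evolves with generator `F ≤ -λ I` along the unperturbed flow, so weighted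
lengths of paths shrink at rate `λ`, while the disturbance moves the end point `P₂` at weighted
speed at most `‖Θ d‖`. Hence `R' ≤ -λ R + ‖Θ d‖`, and the basic estimate is its integrated form.
Differentiating `R` directly is awkward: it is an infimum over paths, and `d` is only integrable in
time along `P₂`.

The proof discretises time instead. The Euler map `x ↦ x + h f(x, t)` carries paths to paths. A
first-order expansion of `Θ` at the image, applied to the image of a tangent vector, shows that this
map multiplies weighted lengths by at most `exp ((-λ + ε) h)`, uniformly on compact sets
(`exists_euler_contraction`, `exists_pathDist_euler_le`). An arc of the perturbed system misses its
own Euler step by a segment of weighted length at most the integral of `‖Θ u‖ + ε (‖u‖ + 1)`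
(`IsPerturbedArc.exists_pathDist_euler_error_le`). The triangle inequality through the two Euler
points gives a one-step recursion for `R`; iterating it over a uniform partition and letting `ε → 0`
gives `IsContracting.pathDist_le`.

The rest follows from this estimate. A bound `D` on `‖Θ d‖` integrates against the exponential
kernel to the error ball. For `ℒ_p`, the bound `M ≥ m I` controls both `‖P₂ - P₁‖` and `‖d‖` by
weighted quantities at the cost of `1 / √m`; convolution with `exp (-λ s)` has `L^p` gain at most
its mass `1 / λ` (`eLpNorm_expConvolution_le`), and the initial term has `L^p` norm at most `ζ`. For
ISS, the estimate on finite intervals is also the a priori bound that excludes blow-up. The initial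
distance is then compared with the norm: linearly if `M` is bounded above, otherwise through the
growth of `Θ` around `P₁ t₀`, which makes `β` depend on `t₀` and `P₁`. -/

theorem pathLength_nonneg (W : E → E →L[ℝ] E) (γ : ℝ → E) : 0 ≤ pathLength W γ :=
  intervalIntegral.integral_nonneg zero_le_one fun _ _ => norm_nonneg _

theorem pathDist_nonneg (W : E → E →L[ℝ] E) (x y : E) : 0 ≤ pathDist W x y := by
  refine Real.sInf_nonneg ?_
  rintro _ ⟨γ, -, -, -, rfl⟩
  exact pathLength_nonneg W γ

theorem pathDist_le_integral (W : E → E →L[ℝ] E) {γ γ' : ℝ → E}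
    (hγ : ∀ s ∈ Icc (0 : ℝ) 1, HasDerivWithinAt γ (γ' s) (Icc 0 1) s)
    (hγ' : ContinuousOn γ' (Icc 0 1)) :
    pathDist W (γ 0) (γ 1) ≤ ∫ s in (0 : ℝ)..1, ‖W (γ s) (γ' s)‖ := by
  have hu : UniqueDiffOn ℝ (Icc (0 : ℝ) 1) := uniqueDiffOn_Icc zero_lt_one
  have hd : EqOn (derivWithin γ (Icc 0 1)) γ' (Icc 0 1) := fun s hs =>
    (hγ s hs).derivWithin (hu s hs)
  have hlen : pathLength W γ = ∫ s in (0 : ℝ)..1, ‖W (γ s) (γ' s)‖ := by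
    refine intervalIntegral.integral_congr fun s hs => ?_
    rw [uIcc_of_le zero_le_one] at hs
    simp only [hd hs]
  rw [← hlen]
  refine csInf_le ⟨0, ?_⟩ ⟨γ, ?_, rfl, rfl, rfl⟩
  · rintro _ ⟨γ, -, -, -, rfl⟩
    exact pathLength_nonneg W γ
  · rw [contDiffOn_one_iff_derivWithin hu]
    exact ⟨fun s hs => (hγ s hs).differentiableWithinAt, hγ'.congr hd⟩

theorem pathDist_le_of_segment (W : E → E →L[ℝ] E) (x y : E) {B : ℝ}
    (hB : ∀ s ∈ Icc (0 : ℝ) 1, ‖W (x + s • (y - x)) (y - x)‖ ≤ B) : pathDist W x y ≤ B := by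
  have h := pathDist_le_integral W (γ := fun s : ℝ => x + s • (y - x)) (γ' := fun _ => y - x)
    (fun s _ => by
      simpa using (((hasDerivAt_id s).smul_const (y - x)).const_add x).hasDerivWithinAt)
    continuousOn_const
  simp only [zero_smul, add_zero, one_smul, add_sub_cancel] at h
  refine h.trans ?_
  have hb := intervalIntegral.norm_integral_le_of_norm_le_const (a := (0 : ℝ)) (b := 1) (C := B)
    (f := fun s : ℝ => ‖W (x + s • (y - x)) (y - x)‖) (fun s hs => by
      rw [uIoc_of_le zero_le_one] at hs
      simpa using hB s ⟨hs.1.le, hs.2⟩)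
  simpa using (le_abs_self _).trans hb

/-- These points are global extrema of the transition function. Paths reparametrised by it therefore
start and stop at zero speed, so they can be joined without losing `C¹` regularity. -/
theorem Real.deriv_smoothTransition_eq_zero {s : ℝ} (hs : s ≤ 0 ∨ 1 ≤ s) :
    deriv Real.smoothTransition s = 0 := by
  rcases hs with hs | hs
  · refine IsLocalMin.deriv_eq_zero (Eventually.of_forall fun t => ?_)
    rw [Real.smoothTransition.zero_of_nonpos hs]
    exact Real.smoothTransition.nonneg t
  · refine IsLocalMax.deriv_eq_zero (Eventually.of_forall fun t => ?_)
    rw [Real.smoothTransition.one_of_one_le hs]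
    exact Real.smoothTransition.le_one t

theorem Real.deriv_smoothTransition_nonneg (s : ℝ) : 0 ≤ deriv Real.smoothTransition s :=
  Real.smoothTransition.monotone.deriv_nonneg

theorem Real.hasDerivAt_smoothTransition (s : ℝ) :
    HasDerivAt Real.smoothTransition (deriv Real.smoothTransition s) s :=
  ((Real.smoothTransition.contDiff (n := 1)).differentiable (by simp) s).hasDerivAt

theorem Real.continuous_deriv_smoothTransition : Continuous (deriv Real.smoothTransition) :=
  (Real.smoothTransition.contDiff (n := 1)).continuous_deriv (by simp)

theorem Real.smoothTransition_mem_Icc (s : ℝ) : Real.smoothTransition s ∈ Icc (0 : ℝ) 1 :=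
  ⟨Real.smoothTransition.nonneg s, Real.smoothTransition.le_one s⟩

/-- Almost minimal paths can be taken continuously differentiable on the whole line and constant
outside of the unit interval. -/
theorem exists_path_length_lt {W : E → E →L[ℝ] E} (hW : Continuous W) (x y : E) {ε : ℝ}
    (hε : 0 < ε) :
    ∃ γ γ' : ℝ → E, (∀ s, HasDerivAt γ (γ' s) s) ∧ Continuous γ' ∧
      (∀ s ≤ 0, γ s = x ∧ γ' s = 0) ∧ (∀ s, 1 ≤ s → γ s = y ∧ γ' s = 0) ∧
      ∫ s in (0 : ℝ)..1, ‖W (γ s) (γ' s)‖ < pathDist W x y + ε := by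
  have hu : UniqueDiffOn ℝ (Icc (0 : ℝ) 1) := uniqueDiffOn_Icc zero_lt_one
  have hne : {L : ℝ | ∃ γ : ℝ → E, ContDiffOn ℝ 1 γ (Icc 0 1) ∧ γ 0 = x ∧ γ 1 = y ∧
      L = pathLength W γ}.Nonempty :=
    ⟨_, fun s => x + s • (y - x), by fun_prop, by simp, by simp, rfl⟩
  obtain ⟨_, ⟨γ, hγ, h0, h1, rfl⟩, hlt⟩ :=
    exists_lt_of_csInf_lt hne (lt_add_of_pos_right (pathDist W x y) hε)
  rw [contDiffOn_one_iff_derivWithin hu] at hγ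
  obtain ⟨hγd, hγc⟩ := hγ
  -- Reparametrising by `S` keeps the path integral, since `S` is monotone from 0 to 1, and extends
  -- the path to the whole line because `S` takes values in the unit interval.
  set S := Real.smoothTransition with hS
  have hSc : Continuous S := Real.smoothTransition.continuous
  refine ⟨fun s => γ (S s), fun s => deriv S s • derivWithin γ (Icc 0 1) (S s), fun s => ?_, ?_,
    fun s hs => ?_, fun s hs => ?_, ?_⟩
  · exact ((hγd _ (Real.smoothTransition_mem_Icc s)).hasDerivWithinAt.scomp_hasDerivAt s
      (Real.hasDerivAt_smoothTransition s) Real.smoothTransition_mem_Icc)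
  · exact Real.continuous_deriv_smoothTransition.smul
      (hγc.comp_continuous hSc Real.smoothTransition_mem_Icc)
  · exact ⟨by simp [hS, Real.smoothTransition.zero_of_nonpos hs, h0],
      by simp [hS, Real.deriv_smoothTransition_eq_zero (Or.inl hs)]⟩
  · exact ⟨by simp [hS, Real.smoothTransition.one_of_one_le hs, h1],
      by simp [hS, Real.deriv_smoothTransition_eq_zero (Or.inr hs)]⟩
  · refine lt_of_eq_of_lt ?_ hlt
    have hg : ContinuousOn (fun s => ‖W (γ s) (derivWithin γ (Icc 0 1) s)‖) (Icc 0 1) :=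
      ((hW.comp_continuousOn hγd.continuousOn).clm_apply hγc).norm
    have h := intervalIntegral.integral_comp_mul_deriv'' (a := 0) (b := 1) (f := S) (f' := deriv S)
      (g := fun s => ‖W (γ s) (derivWithin γ (Icc 0 1) s)‖) hSc.continuousOn
      (fun s _ => (Real.hasDerivAt_smoothTransition s).hasDerivWithinAt)
      Real.continuous_deriv_smoothTransition.continuousOn
      (hg.mono (by rintro _ ⟨s, -, rfl⟩; exact Real.smoothTransition_mem_Icc s))
    rw [hS, Real.smoothTransition.zero, Real.smoothTransition.one, ← hS] at h
    rw [pathLength, ← h]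
    refine intervalIntegral.integral_congr fun s _ => ?_
    simp only [map_smul, norm_smul, Function.comp_apply, Real.norm_eq_abs,
      abs_of_nonneg (Real.deriv_smoothTransition_nonneg s), hS]
    ring

/-- Both almost minimal paths are constant outside the unit interval, so their concatenation is the
single `C¹` formula `γ(2s) + (δ(2s - 1) - y)`: on each half one of the two summands is frozen, and
no case distinction is needed. -/
theorem pathDist_triangle {W : E → E →L[ℝ] E} (hW : Continuous W) (x y z : E) :
    pathDist W x z ≤ pathDist W x y + pathDist W y z := by
  refine le_of_forall_pos_le_add fun ε hε => ?_
  obtain ⟨γ, γ', hγ, hγ', h0, h1, hlt⟩ := exists_path_length_lt hW x y (half_pos hε)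
  obtain ⟨δ, δ', hδ, hδ', k0, k1, klt⟩ := exists_path_length_lt hW y z (half_pos hε)
  have hγc : Continuous γ := continuous_iff_continuousAt.2 fun s => (hγ s).continuousAt
  have hδc : Continuous δ := continuous_iff_continuousAt.2 fun s => (hδ s).continuousAt
  have hd : ∀ s : ℝ, HasDerivAt (fun s => γ (2 * s) + (δ (2 * s - 1) - y))
      ((2 : ℝ) • γ' (2 * s) + (2 : ℝ) • δ' (2 * s - 1)) s := fun s => by
    have a1 : HasDerivAt (fun s : ℝ => 2 * s) 2 s := by
      simpa using (hasDerivAt_id s).const_mul (2 : ℝ)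
    exact ((hγ (2 * s)).scomp s a1).add (((hδ (2 * s - 1)).scomp s (a1.sub_const 1)).sub_const y)
  have hc : Continuous fun s : ℝ => (2 : ℝ) • γ' (2 * s) + (2 : ℝ) • δ' (2 * s - 1) := by
    fun_prop
  have hle := pathDist_le_integral W (fun s _ => (hd s).hasDerivWithinAt) hc.continuousOn
  have e0 : γ (2 * 0) + (δ (2 * 0 - 1) - y) = x := by
    rw [(h0 _ (by norm_num)).1, (k0 _ (by norm_num)).1]; simp
  have e1 : γ (2 * 1) + (δ (2 * 1 - 1) - y) = z := by
    rw [(h1 _ (by norm_num)).1, (k1 _ (by norm_num)).1]; simp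
  rw [e0, e1] at hle
  refine hle.trans ?_
  have hint : Continuous fun s : ℝ => ‖W (γ (2 * s) + (δ (2 * s - 1) - y))
      ((2 : ℝ) • γ' (2 * s) + (2 : ℝ) • δ' (2 * s - 1))‖ := by fun_prop
  rw [← intervalIntegral.integral_add_adjacent_intervals (b := 1 / 2)
    (hint.intervalIntegrable _ _) (hint.intervalIntegrable _ _)]
  have i1 : ∫ s in (0 : ℝ)..(1 / 2), ‖W (γ (2 * s) + (δ (2 * s - 1) - y))
      ((2 : ℝ) • γ' (2 * s) + (2 : ℝ) • δ' (2 * s - 1))‖ =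
      ∫ s in (0 : ℝ)..1, ‖W (γ s) (γ' s)‖ := by
    have h := intervalIntegral.smul_integral_comp_mul_left (a := 0) (b := 1 / 2)
      (fun s => ‖W (γ s) (γ' s)‖) 2
    norm_num at h
    rw [← h, ← intervalIntegral.integral_const_mul]
    refine intervalIntegral.integral_congr fun s hs => ?_
    rw [uIcc_of_le (by norm_num)] at hs
    have hs2 : 2 * s - 1 ≤ 0 := by linarith [hs.2]
    simp [(k0 _ hs2).1, (k0 _ hs2).2, norm_smul]
  have i2 : ∫ s in (1 / 2 : ℝ)..1, ‖W (γ (2 * s) + (δ (2 * s - 1) - y))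
      ((2 : ℝ) • γ' (2 * s) + (2 : ℝ) • δ' (2 * s - 1))‖ =
      ∫ s in (0 : ℝ)..1, ‖W (δ s) (δ' s)‖ := by
    have h := intervalIntegral.smul_integral_comp_mul_sub (a := 1 / 2) (b := 1)
      (fun s => ‖W (δ s) (δ' s)‖) 2 1
    norm_num at h
    rw [← h, ← intervalIntegral.integral_const_mul]
    refine intervalIntegral.integral_congr fun s hs => ?_
    rw [uIcc_of_le (by norm_num)] at hs
    have hs2 : 1 ≤ 2 * s := by linarith [hs.1]
    simp [(h1 _ hs2).1, (h1 _ hs2).2, norm_smul]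
  rw [i1, i2]
  linarith

/-- A path whose derivative is controlled by its weighted speed stays close to its origin. -/
theorem mul_norm_sub_le_integral {W : E → E →L[ℝ] E} (hW : Continuous W) [CompleteSpace E]
    {c : ℝ} (hc : 0 ≤ c)
    (hcW : ∀ x v, c * ‖v‖ ≤ ‖W x v‖) {γ γ' : ℝ → E} (hγ : ∀ s, HasDerivAt γ (γ' s) s)
    (hγ' : Continuous γ') {s : ℝ} (hs : s ∈ Icc (0 : ℝ) 1) :
    c * ‖γ s - γ 0‖ ≤ ∫ s in (0 : ℝ)..1, ‖W (γ s) (γ' s)‖ := by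
  have hγc : Continuous γ := continuous_iff_continuousAt.2 fun s => (hγ s).continuousAt
  have hF : γ s - γ 0 = ∫ r in (0 : ℝ)..s, γ' r :=
    (intervalIntegral.integral_eq_sub_of_hasDerivAt (fun r _ => hγ r)
      (hγ'.intervalIntegrable _ _)).symm
  have hint : Continuous fun r => ‖W (γ r) (γ' r)‖ := by fun_prop
  calc c * ‖γ s - γ 0‖ ≤ c * ∫ r in (0 : ℝ)..s, ‖γ' r‖ := by
        rw [hF]
        exact mul_le_mul_of_nonneg_left
          (intervalIntegral.norm_integral_le_integral_norm hs.1) hc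
    _ = ∫ r in (0 : ℝ)..s, c * ‖γ' r‖ := by rw [intervalIntegral.integral_const_mul]
    _ ≤ ∫ r in (0 : ℝ)..s, ‖W (γ r) (γ' r)‖ :=
        intervalIntegral.integral_mono_on hs.1
          ((continuous_const.mul hγ'.norm).intervalIntegrable _ _)
          (hint.intervalIntegrable _ _) fun r _ => hcW _ _
    _ ≤ ∫ r in (0 : ℝ)..1, ‖W (γ r) (γ' r)‖ :=
        intervalIntegral.integral_mono_interval le_rfl hs.1 hs.2
          (Eventually.of_forall fun _ => norm_nonneg _) (hint.intervalIntegrable _ _)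

theorem mul_norm_sub_le_pathDist [CompleteSpace E] {W : E → E →L[ℝ] E} (hW : Continuous W)
    {c : ℝ} (hc : 0 ≤ c) (hcW : ∀ x v, c * ‖v‖ ≤ ‖W x v‖) (x y : E) :
    c * ‖y - x‖ ≤ pathDist W x y := by
  refine le_of_forall_pos_le_add fun ε hε => ?_
  obtain ⟨γ, γ', hγ, hγ', h0, h1, hlt⟩ := exists_path_length_lt hW x y hε
  have h := mul_norm_sub_le_integral hW hc hcW hγ hγ' (s := 1) (by simp)
  rw [(h0 0 le_rfl).1, (h1 1 le_rfl).1] at h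
  exact h.trans hlt.le

theorem euclidPathDist_le (x y : E) : euclidPathDist x y ≤ ‖y - x‖ :=
  pathDist_le_of_segment _ x y fun _ _ => le_rfl

end PathDist

section PathDistComm

variable {E : Type*} [NormedAddCommGroup E] [InnerProductSpace ℝ E]

/-- Reversing a path preserves its length. Symmetry is needed because local errors are measured from
the Euler point to the arc, while the triangle inequality for `P₁` runs the other way. -/
theorem pathDist_comm {W : E → E →L[ℝ] E} (hW : Continuous W) (x y : E) :
    pathDist W x y = pathDist W y x := by
  have key : ∀ x y : E, pathDist W y x ≤ pathDist W x y := fun x y => by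
    refine le_of_forall_pos_le_add fun ε hε => ?_
    obtain ⟨γ, γ', hγ, hγ', h0, h1, hlt⟩ := exists_path_length_lt hW x y hε
    have hd : ∀ s : ℝ, HasDerivAt (fun s => γ (1 - s)) ((-1 : ℝ) • γ' (1 - s)) s := fun s =>
      (hγ (1 - s)).scomp s (by simpa using (hasDerivAt_id s).const_sub (1 : ℝ))
    have hle := pathDist_le_integral W (fun s _ => (hd s).hasDerivWithinAt)
      (by fun_prop : Continuous fun s : ℝ => (-1 : ℝ) • γ' (1 - s)).continuousOn
    have hrev := intervalIntegral.integral_comp_sub_left (a := 0) (b := 1)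
      (fun s => ‖W (γ s) (γ' s)‖) 1
    simp only [sub_zero, sub_self, neg_smul, one_smul, map_neg, norm_neg, (h0 0 le_rfl).1,
      (h1 1 le_rfl).1] at hle hrev
    rw [hrev] at hle
    exact hle.trans hlt.le
  exact le_antisymm (key y x) (key x y)

end PathDistComm

/-! ### Partial derivatives of `C¹` functions on `E × [0, ∞)`, one-sided in time at 0 -/

section PartialDerivatives

variable {E : Type*} [NormedAddCommGroup E] [NormedSpace ℝ E]
  {G : Type*} [NormedAddCommGroup G] [NormedSpace ℝ G]

/-- The derivative of `(x, t) ↦ g x t` on `E × [0, ∞)`. -/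
noncomputable def totalDeriv (g : E → ℝ → G) (x : E) (t : ℝ) : E × ℝ →L[ℝ] G :=
  fderivWithin ℝ (Function.uncurry g) (univ ×ˢ Ici 0) (x, t)

theorem uniqueDiffOn_univ_prod_Ici : UniqueDiffOn ℝ ((univ : Set E) ×ˢ Ici (0 : ℝ)) :=
  uniqueDiffOn_univ.prod (uniqueDiffOn_Ici 0)

variable {g : E → ℝ → G} (hg : ContDiffOn ℝ 1 (Function.uncurry g) (univ ×ˢ Ici 0))
include hg

theorem continuousOn_totalDeriv :
    ContinuousOn (fun q : E × ℝ => totalDeriv g q.1 q.2) (univ ×ˢ Ici 0) :=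
  hg.continuousOn_fderivWithin uniqueDiffOn_univ_prod_Ici le_rfl

theorem hasFDerivWithinAt_totalDeriv {x : E} {t : ℝ} (ht : 0 ≤ t) :
    HasFDerivWithinAt (Function.uncurry g) (totalDeriv g x t) (univ ×ˢ Ici 0) (x, t) :=
  ((hg.differentiableOn one_ne_zero) (x, t) ⟨trivial, ht⟩).hasFDerivWithinAt

theorem hasFDerivAt_space {x : E} {t : ℝ} (ht : 0 ≤ t) :
    HasFDerivAt (fun y => g y t)
      ((totalDeriv g x t).comp (ContinuousLinearMap.inl ℝ E ℝ)) x := by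
  rw [← hasFDerivWithinAt_univ]
  exact (hasFDerivWithinAt_totalDeriv hg ht).comp (f := fun y : E => (y, t)) x
    (hasFDerivAt_prodMk_left x t).hasFDerivWithinAt (fun y _ => ⟨trivial, ht⟩)

theorem fderiv_space_apply {x : E} {t : ℝ} (ht : 0 ≤ t) (v : E) :
    fderiv ℝ (fun y => g y t) x v = totalDeriv g x t (v, 0) := by
  rw [(hasFDerivAt_space hg ht).fderiv]; rfl

theorem continuousOn_fderiv_space :
    ContinuousOn (fun q : E × ℝ => fderiv ℝ (fun y => g y q.2) q.1) (univ ×ˢ Ici 0) :=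
  ((continuousOn_totalDeriv hg).clm_comp continuousOn_const).congr fun _ hq =>
    (hasFDerivAt_space hg hq.2).fderiv

theorem hasDerivWithinAt_along {c : ℝ → E} {c' : E} {s : ℝ} {t : ℝ} (ht : 0 ≤ t)
    {S : Set ℝ} (hS : S ⊆ Ici 0) (hs : s ∈ S) (hc : HasDerivWithinAt c c' S s) :
    HasDerivWithinAt (fun h => g (c h) (t + h)) (totalDeriv g (c s) (t + s) (c', 1)) S s := by
  have h1 : HasDerivWithinAt (fun h : ℝ => (c h, t + h)) (c', 1) S s :=
    hc.prodMk ((hasDerivWithinAt_id s S).const_add t)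
  have hm : MapsTo (fun h : ℝ => (c h, t + h)) S (univ ×ˢ Ici 0) := fun h hh =>
    ⟨trivial, add_nonneg ht (mem_Ici.1 (hS hh))⟩
  exact (hasFDerivWithinAt_totalDeriv hg (x := c s)
    (add_nonneg ht (mem_Ici.1 (hS hs)))).comp_hasDerivWithinAt s h1 hm

theorem derivWithin_time {x : E} {t : ℝ} (ht : 0 ≤ t) :
    derivWithin (fun s => g x s) (Ici 0) t = totalDeriv g x t (0, 1) := by
  refine HasDerivWithinAt.derivWithin ?_ (uniqueDiffOn_Ici 0 t ht)
  exact (hasFDerivWithinAt_totalDeriv hg ht).comp_hasDerivWithinAt (f := fun s : ℝ => (x, s)) t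
    ((hasDerivWithinAt_const t (Ici 0) x).prodMk (hasDerivWithinAt_id t _))
    fun s hs => ⟨trivial, hs⟩

theorem continuous_slice {t : ℝ} (ht : 0 ≤ t) : Continuous fun x => g x t :=
  hg.continuousOn.comp_continuous (f := fun x : E => (x, t)) (by fun_prop) fun _ => ⟨trivial, ht⟩

end PartialDerivatives

/-! ### Contraction of weighted lengths by one Euler step -/

section OneStep

variable {E : Type*} [NormedAddCommGroup E] [InnerProductSpace ℝ E] [CompleteSpace E]
  {f : E → ℝ → E} {Θ : E → ℝ → E →L[ℝ] E} {lam m : ℝ}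

namespace IsContracting

variable (hc : IsContracting f Θ lam m)
include hc

theorem sqrt_mul_norm_le {x : E} {t : ℝ} (ht : 0 ≤ t) (v : E) : √m * ‖v‖ ≤ ‖Θ x t v‖ := by
  have h := hc.metric_lower x t ht v
  rw [metricTensor, ContinuousLinearMap.comp_apply, ContinuousLinearMap.adjoint_inner_right,
    real_inner_self_eq_norm_sq] at h
  refine le_of_sq_le_sq ?_ (norm_nonneg _)
  rwa [mul_pow, Real.sq_sqrt hc.lower_pos.le]

/-- The lower bound on the metric makes `Θ x t` injective, hence invertible in finite dimension, so
that `inverse` is not its default value 0. -/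
theorem inverse_apply [FiniteDimensional ℝ E] {x : E} {t : ℝ} (ht : 0 ≤ t) (v : E) :
    (Θ x t).inverse (Θ x t v) = v := by
  have hinj : Function.Injective (Θ x t : E →ₗ[ℝ] E) := by
    rw [← LinearMap.ker_eq_bot, LinearMap.ker_eq_bot']
    intro v hv
    have h := hc.sqrt_mul_norm_le (x := x) ht v
    rw [show Θ x t v = 0 from hv, norm_zero] at h
    have hs := Real.sqrt_pos.2 hc.lower_pos
    exact norm_le_zero_iff.1 (by nlinarith [norm_nonneg v])
  let e : E ≃L[ℝ] E := (LinearEquiv.ofInjectiveEndo _ hinj).toContinuousLinearEquiv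
  have he : (e : E →L[ℝ] E) = Θ x t := by ext w; rfl
  rw [← he, ContinuousLinearMap.inverse_equiv]
  exact e.symm_apply_apply v

/-- The generator of the evolution of `Θ δx`, without the factor `Θ⁻¹`. -/
theorem inner_le [FiniteDimensional ℝ E] {x : E} {t : ℝ} (ht : 0 ≤ t) (v : E) :
    inner ℝ (Θ x t v) (totalDeriv Θ x t (f x t, 1) v + Θ x t (fderiv ℝ (fun y => f y t) x v)) ≤
      -lam * ‖Θ x t v‖ ^ 2 := by
  have h := hc.jacobian_upper x t ht (Θ x t v)
  rw [generalizedJacobian, ContinuousLinearMap.comp_apply, hc.inverse_apply ht] at h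
  have hd : derivAlong f Θ x t = totalDeriv Θ x t (f x t, 1) := by
    rw [derivAlong, derivWithin_time hc.contDiffOn_factor ht,
      fderiv_space_apply hc.contDiffOn_factor ht, ← map_add]
    simp
  rwa [hd] at h

/-- The infinitesimal contraction estimate for the Euler map `x ↦ x + h f(x, t)`, uniform on
compact sets. -/
theorem exists_euler_contraction [FiniteDimensional ℝ E] {K : Set E} (hK : IsCompact K) (T : ℝ)
    {ε : ℝ} (hε : 0 < ε) :
    ∃ δ > 0, ∀ x ∈ K, ∀ t ∈ Icc 0 T, ∀ h ∈ Icc 0 δ, ∀ v,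
      ‖Θ (x + h • f x t) (t + h) (v + h • fderiv ℝ (fun y => f y t) x v)‖ ≤
        Real.exp ((-lam + ε) * h) * ‖Θ x t v‖ := by
  have hm := Real.sqrt_pos.2 hc.lower_pos
  let A : E × ℝ → E →L[ℝ] E := fun q => fderiv ℝ (fun y => f y q.2) q.1
  -- This is the derivative in `r` of `Ψ r = Θ(x + r f, t + r) ∘ (1 + r ∂f/∂x)`, the weight pulled
  -- back by the Euler map. At `r = 0` it equals `Θ̇ + Θ ∂f/∂x`.
  let ψ : (E × ℝ) × ℝ → E →L[ℝ] E := fun q =>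
    (totalDeriv Θ (q.1.1 + q.2 • f q.1.1 q.1.2) (q.1.2 + q.2) (f q.1.1 q.1.2, 1)).comp
      (ContinuousLinearMap.id ℝ E + q.2 • A q.1) +
    (Θ (q.1.1 + q.2 • f q.1.1 q.1.2) (q.1.2 + q.2)).comp (A q.1)
  let U : Set ((E × ℝ) × ℝ) := (univ ×ˢ Ici 0) ×ˢ Ici 0
  have hfst : ContinuousOn (fun q : (E × ℝ) × ℝ => q.1) U := continuousOn_fst
  have hmaps : MapsTo (fun q : (E × ℝ) × ℝ => q.1) U (univ ×ˢ Ici 0) := fun q hq => hq.1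
  have hfc : ContinuousOn (fun q : (E × ℝ) × ℝ => f q.1.1 q.1.2) U :=
    hc.contDiffOn_field.continuousOn.comp hfst hmaps
  have hAc : ContinuousOn (fun q : (E × ℝ) × ℝ => A q.1) U :=
    (continuousOn_fderiv_space hc.contDiffOn_field).comp hfst hmaps
  have hpt : ContinuousOn (fun q : (E × ℝ) × ℝ =>
      (q.1.1 + q.2 • f q.1.1 q.1.2, q.1.2 + q.2)) U :=
    ((continuous_fst.comp continuous_fst).continuousOn.add (continuousOn_snd.smul hfc)).prodMk
      (by fun_prop)
  have hpm : MapsTo (fun q : (E × ℝ) × ℝ => (q.1.1 + q.2 • f q.1.1 q.1.2, q.1.2 + q.2)) U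
      (univ ×ˢ Ici 0) := fun q hq =>
    ⟨trivial, add_nonneg (mem_Ici.1 hq.1.2) (mem_Ici.1 hq.2)⟩
  have hDc : ContinuousOn (fun q : (E × ℝ) × ℝ =>
      totalDeriv Θ (q.1.1 + q.2 • f q.1.1 q.1.2) (q.1.2 + q.2)) U :=
    (continuousOn_totalDeriv hc.contDiffOn_factor).comp hpt hpm
  have hΘc : ContinuousOn (fun q : (E × ℝ) × ℝ =>
      Θ (q.1.1 + q.2 • f q.1.1 q.1.2) (q.1.2 + q.2)) U :=
    hc.contDiffOn_factor.continuousOn.comp hpt hpm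
  have hψ : ContinuousOn ψ U := by
    refine ContinuousOn.add (ContinuousOn.clm_comp (hDc.clm_apply (hfc.prodMk continuousOn_const))
      ?_) (hΘc.clm_comp hAc)
    exact continuousOn_const.add (continuousOn_snd.smul hAc)
  have hcomp : IsCompact ((K ×ˢ Icc 0 T) ×ˢ Icc (0 : ℝ) 1) :=
    (hK.prod isCompact_Icc).prod isCompact_Icc
  have hsub : (K ×ˢ Icc 0 T) ×ˢ Icc (0 : ℝ) 1 ⊆ U := fun q hq => ⟨⟨trivial, hq.1.2.1⟩, hq.2.1⟩
  obtain ⟨C, hC⟩ := hcomp.exists_bound_of_continuousOn (hψ.mono hsub)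
  have huc := hcomp.uniformContinuousOn_of_continuous (hψ.mono hsub)
  rw [Metric.uniformContinuousOn_iff] at huc
  -- Half of `ε` is reserved for the linearisation error. The factor `√m` converts `‖v‖` into `‖Θ
  -- v‖`, and `exp (-lam)` is a lower bound for the contraction factor when `h ≤ 1`.
  set ε' := √m * (Real.exp (-lam) * (ε / 2)) with hε'
  have hε'pos : 0 < ε' := by positivity
  obtain ⟨δ₀, hδ₀, hδ⟩ := huc ε' hε'pos
  -- The first bound gives uniform continuity of `ψ`, the second keeps `h` in the compact set, and
  -- the third lets the term `h² ‖b‖²` be absorbed into `ε h ‖w‖²`.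
  refine ⟨min (min (δ₀ / 2) 1) (ε / (C ^ 2 / m + 1)), ?_, fun x hx t ht h hh v => ?_⟩
  · have := hc.lower_pos
    positivity
  have hh0 : 0 ≤ h := hh.1
  have hh1 : h ≤ 1 := hh.2.trans ((min_le_left _ _).trans (min_le_right _ _))
  have hhδ : h < δ₀ := lt_of_le_of_lt (hh.2.trans ((min_le_left _ _).trans (min_le_left _ _)))
    (half_lt_self hδ₀)
  have hhC : h * (C ^ 2 / m) ≤ ε := by
    have h1 : h ≤ ε / (C ^ 2 / m + 1) := hh.2.trans (min_le_right _ _)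
    have hp : 0 ≤ C ^ 2 / m := div_nonneg (sq_nonneg _) hc.lower_pos.le
    rw [le_div_iff₀ (by positivity)] at h1
    nlinarith
  let Ψ : ℝ → E →L[ℝ] E := fun r =>
    (Θ (x + r • f x t) (t + r)).comp (ContinuousLinearMap.id ℝ E + r • A (x, t))
  have hΨ : ∀ r ∈ Icc (0 : ℝ) h, HasDerivWithinAt Ψ (ψ ((x, t), r)) (Icc 0 h) r := fun r hr => by
    have hl : HasDerivWithinAt (fun r : ℝ => x + r • f x t) (f x t) (Icc 0 h) r := by
      simpa using (((hasDerivAt_id r).smul_const (f x t)).const_add x).hasDerivWithinAt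
    have h1 := hasDerivWithinAt_along hc.contDiffOn_factor ht.1 (S := Icc 0 h)
      (fun _ hs => hs.1) hr hl
    have h2 : HasDerivWithinAt (fun r : ℝ => ContinuousLinearMap.id ℝ E + r • A (x, t)) (A (x, t))
        (Icc 0 h) r := by
      simpa using (((hasDerivAt_id r).smul_const (A (x, t))).const_add
        (ContinuousLinearMap.id ℝ E)).hasDerivWithinAt
    exact h1.clm_comp h2
  -- Mean value inequality for `Ψ r - r ψ(0)`, whose derivative stays within `ε'` of zero.
  have hlin : ‖Ψ h - h • ψ ((x, t), 0) - Ψ 0‖ ≤ ε' * h := by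
    have hb := norm_image_sub_le_of_norm_deriv_le_segment' (a := 0) (b := h) (C := ε')
      (f := fun r => Ψ r - r • ψ ((x, t), 0)) (f' := fun r => ψ ((x, t), r) - ψ ((x, t), 0))
      (fun r hr => (hΨ r hr).sub (by
        simpa using ((hasDerivAt_id r).smul_const (ψ ((x, t), 0))).hasDerivWithinAt))
      (fun r hr => by
        rw [← dist_eq_norm]
        refine (hδ _ ⟨⟨hx, ht⟩, hr.1, hr.2.le.trans hh1⟩ _ ⟨⟨hx, ht⟩, le_rfl, zero_le_one⟩ ?_).le
        rw [Prod.dist_eq, dist_self, Real.dist_eq, sub_zero, abs_of_nonneg hr.1,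
          max_eq_right hr.1]
        exact hr.2.trans hhδ) h ⟨hh0, le_rfl⟩
    simpa using hb
  have hΨ0 : Ψ 0 = Θ x t := by simp [Ψ]
  set w := Θ x t v with hw
  set b := ψ ((x, t), 0) v with hb
  have hbw : inner ℝ w b ≤ -lam * ‖w‖ ^ 2 := by
    have := hc.inner_le (x := x) ht.1 v
    simpa [hb, ψ, A] using this
  have hvw : ‖v‖ ≤ ‖w‖ / √m := by
    rw [le_div_iff₀ hm, mul_comm]
    exact hc.sqrt_mul_norm_le ht.1 v
  have hC0 : 0 ≤ C := (norm_nonneg _).trans (hC ((x, t), 0) ⟨⟨hx, ht⟩, le_rfl, zero_le_one⟩)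
  have hbn : ‖b‖ ^ 2 ≤ C ^ 2 / m * ‖w‖ ^ 2 := by
    have h1 : ‖b‖ ≤ C * (‖w‖ / √m) :=
      ((ψ ((x, t), 0)).le_of_opNorm_le (hC _ ⟨⟨hx, ht⟩, le_rfl, zero_le_one⟩) v).trans
        (mul_le_mul_of_nonneg_left hvw hC0)
    calc ‖b‖ ^ 2 ≤ (C * (‖w‖ / √m)) ^ 2 := by gcongr
      _ = C ^ 2 / m * ‖w‖ ^ 2 := by
        rw [mul_pow, div_pow, Real.sq_sqrt hc.lower_pos.le]; ring
  -- After squaring, the cross term contributes `-2 lam h` and the quadratic term at most `ε h`, so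
  -- `1 + x ≤ exp x` suffices.
  have hmain : ‖w + h • b‖ ≤ Real.exp ((-lam + ε / 2) * h) * ‖w‖ := by
    refine le_of_sq_le_sq ?_ (by positivity)
    rw [norm_add_sq_real, inner_smul_right, norm_smul, mul_pow, mul_pow, Real.norm_eq_abs, sq_abs]
    have he : Real.exp ((-lam + ε / 2) * h) ^ 2 = Real.exp ((-2 * lam + ε) * h) := by
      rw [← Real.exp_nat_mul]; congr 1; push_cast; ring
    rw [he]
    have h1 := Real.add_one_le_exp ((-2 * lam + ε) * h)
    have h2 : h ^ 2 * ‖b‖ ^ 2 ≤ h * (ε * ‖w‖ ^ 2) := by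
      calc h ^ 2 * ‖b‖ ^ 2 ≤ h ^ 2 * (C ^ 2 / m * ‖w‖ ^ 2) := by gcongr
        _ = h * ((h * (C ^ 2 / m)) * ‖w‖ ^ 2) := by ring
        _ ≤ h * (ε * ‖w‖ ^ 2) := by gcongr
    have h3 : h * inner ℝ w b ≤ h * (-lam * ‖w‖ ^ 2) := by gcongr
    nlinarith [mul_le_mul_of_nonneg_right h1 (sq_nonneg ‖w‖)]
  have happ : Θ (x + h • f x t) (t + h) (v + h • fderiv ℝ (fun y => f y t) x v) =
      (w + h • b) + (Ψ h - h • ψ ((x, t), 0) - Ψ 0) v := by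
    rw [hΨ0]
    simp only [Ψ, A, sub_apply, ContinuousLinearMap.comp_apply,
      add_apply, ContinuousLinearMap.id_apply, smul_apply,
      ← hw, ← hb]
    abel
  rw [happ]
  have hexp : Real.exp ((-lam + ε / 2) * h) + Real.exp (-lam) * (ε / 2) * h ≤
      Real.exp ((-lam + ε) * h) := by
    have h1 : (-lam + ε) * h = (-lam + ε / 2) * h + ε / 2 * h := by ring
    have h2 : Real.exp (-lam) ≤ Real.exp ((-lam + ε / 2) * h) := by
      refine Real.exp_le_exp.2 ?_
      nlinarith [hc.rate_pos]
    rw [h1, Real.exp_add]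
    have h3 := Real.add_one_le_exp (ε / 2 * h)
    have h4 : 0 ≤ ε / 2 * h := by positivity
    nlinarith [Real.exp_pos ((-lam + ε / 2) * h)]
  calc ‖(w + h • b) + (Ψ h - h • ψ ((x, t), 0) - Ψ 0) v‖
      ≤ ‖w + h • b‖ + ε' * h * (‖w‖ / √m) :=
        (norm_add_le _ _).trans (add_le_add_right
          ((ContinuousLinearMap.le_of_opNorm_le _ hlin v).trans
            (mul_le_mul_of_nonneg_left hvw (by positivity))) _)
    _ ≤ Real.exp ((-lam + ε / 2) * h) * ‖w‖ + Real.exp (-lam) * (ε / 2) * h * ‖w‖ := by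
        refine add_le_add hmain (le_of_eq ?_)
        rw [hε']; field_simp
    _ ≤ Real.exp ((-lam + ε) * h) * ‖w‖ := by
        rw [← add_mul]; gcongr

/-- One Euler step contracts the smallest path integral, uniformly on bounded sets. -/
theorem exists_pathDist_euler_le [FiniteDimensional ℝ E] (r L T : ℝ) {ε : ℝ} (hε : 0 < ε) :
    ∃ δ > 0, ∀ t ∈ Icc 0 T, ∀ h ∈ Icc 0 δ, ∀ x y : E, ‖x‖ ≤ r →
      pathDist (fun z => Θ z t) x y ≤ L →
      pathDist (fun z => Θ z (t + h)) (x + h • f x t) (y + h • f y t) ≤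
        Real.exp ((-lam + ε) * h) * pathDist (fun z => Θ z t) x y := by
  have hm := Real.sqrt_pos.2 hc.lower_pos
  -- A path from the ball of radius `r` with weighted length below `L + 1` cannot move farther than
  -- `(L + 1) / √m`; one compact ball thus contains all the paths used.
  obtain ⟨δ, hδ, H⟩ := hc.exists_euler_contraction
    (isCompact_closedBall (0 : E) (r + (L + 1) / √m)) T hε
  refine ⟨δ, hδ, fun t ht h hh x y hx hL => ?_⟩
  set R := pathDist (fun z => Θ z t) x y
  set e := Real.exp ((-lam + ε) * h)
  have hW : Continuous fun z => Θ z t := continuous_slice hc.contDiffOn_factor ht.1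
  have key : ∀ η ∈ Ioc (0 : ℝ) 1, pathDist (fun z => Θ z (t + h)) (x + h • f x t) (y + h • f y t) ≤
      e * (R + η) := fun η hη => by
    obtain ⟨γ, γ', hγ, hγ', h0, h1, hlt⟩ := exists_path_length_lt hW x y hη.1
    have hγc : Continuous γ := continuous_iff_continuousAt.2 fun s => (hγ s).continuousAt
    have hd : ∀ s, HasDerivAt (fun s => γ s + h • f (γ s) t)
        (γ' s + h • fderiv ℝ (fun y => f y t) (γ s) (γ' s)) s := fun s => by
      have hf := (hasFDerivAt_space hc.contDiffOn_field (x := γ s) ht.1)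
      rw [hf.fderiv]
      exact (hγ s).add ((hf.comp_hasDerivAt s (hγ s)).const_smul h)
    have hA : Continuous fun s => fderiv ℝ (fun y => f y t) (γ s) :=
      (continuousOn_fderiv_space hc.contDiffOn_field).comp_continuous
        (f := fun s => (γ s, t)) (by fun_prop) fun _ => ⟨trivial, ht.1⟩
    have hd' : Continuous fun s => γ' s + h • fderiv ℝ (fun y => f y t) (γ s) (γ' s) := by
      fun_prop
    have hle := pathDist_le_integral (fun z => Θ z (t + h))
      (fun s _ => (hd s).hasDerivWithinAt) hd'.continuousOn
    rw [(h0 0 le_rfl).1, (h1 1 le_rfl).1] at hle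
    have hW' : Continuous fun z => Θ z (t + h) :=
      continuous_slice hc.contDiffOn_factor (add_nonneg ht.1 hh.1)
    have hft : Continuous fun z => f z t := continuous_slice hc.contDiffOn_field ht.1
    have hi : Continuous fun s => ‖Θ (γ s + h • f (γ s) t) (t + h)
        (γ' s + h • fderiv ℝ (fun y => f y t) (γ s) (γ' s))‖ :=
      ((hW'.comp (hγc.add ((hft.comp hγc).const_smul h))).clm_apply hd').norm
    have hi' : Continuous fun s => e * ‖Θ (γ s) t (γ' s)‖ :=
      continuous_const.mul ((hW.comp hγc).clm_apply hγ').norm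
    refine hle.trans ?_
    calc _ ≤ ∫ s in (0 : ℝ)..1, e * ‖Θ (γ s) t (γ' s)‖ := by
          refine intervalIntegral.integral_mono_on zero_le_one (hi.intervalIntegrable _ _)
            (hi'.intervalIntegrable _ _) fun s hs => H _ ?_ t ht h hh _
          have hb := mul_norm_sub_le_integral hW hm.le
            (fun x v => hc.sqrt_mul_norm_le (x := x) ht.1 v) hγ hγ' hs
          rw [(h0 0 le_rfl).1] at hb
          have hb' : ‖γ s - x‖ ≤ (L + 1) / √m := by
            rw [le_div_iff₀ hm, mul_comm]
            linarith [hη.2]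
          rw [mem_closedBall_zero_iff]
          calc ‖γ s‖ = ‖x + (γ s - x)‖ := by rw [add_sub_cancel]
            _ ≤ _ := (norm_add_le _ _).trans (add_le_add hx hb')
      _ = e * ∫ s in (0 : ℝ)..1, ‖Θ (γ s) t (γ' s)‖ := intervalIntegral.integral_const_mul _ _
      _ ≤ e * (R + η) := by gcongr
  have hlim : Tendsto (fun η : ℝ => e * (R + η)) (𝓝[>] 0) (𝓝 (e * (R + 0))) :=
    ((continuous_const.mul (continuous_const.add continuous_id)).tendsto 0).mono_left
      nhdsWithin_le_nhds
  rw [add_zero] at hlim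
  refine ge_of_tendsto hlim ?_
  filter_upwards [Ioc_mem_nhdsGT zero_lt_one] with η hη using key η hη

end IsContracting

end OneStep

/-! ### Arcs driven by an integrable perturbation -/

section ContinuousCoefficients

theorem continuousOn_comp_curve {E G : Type*} [TopologicalSpace E] [TopologicalSpace G] {g : E → ℝ → G}
    (hg : ContinuousOn (Function.uncurry g) (univ ×ˢ Ici 0)) {P : ℝ → E} {S : Set ℝ}
    (hS : S ⊆ Ici 0) (hP : ContinuousOn P S) :
    ContinuousOn (fun t => g (P t) t) S :=
  hg.comp (hP.prodMk continuousOn_id) fun _ ht => ⟨trivial, hS ht⟩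

theorem Icc_subset_Ici_zero {t₀ : ℝ} (T : ℝ) (ht₀ : 0 ≤ t₀) : Icc t₀ T ⊆ Ici 0 :=
  fun _ ht => ht₀.trans ht.1

theorem intervalIntegrable_of_mem_Icc {E : Type*} [NormedAddCommGroup E] {v : ℝ → E} {a b s t : ℝ}
    (hv : IntervalIntegrable v volume a b) (hs : s ∈ Icc a b) (ht : t ∈ Icc s b) :
    IntervalIntegrable v volume s t :=
  hv.mono_set (by
    rw [uIcc_of_le ht.1, uIcc_of_le (hs.1.trans hs.2)]
    exact Icc_subset_Icc hs.1 ht.2)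

variable {E : Type*} [NormedAddCommGroup E] [NormedSpace ℝ E]

theorem MeasureTheory.MemLp.clm_apply_continuousOn {A : ℝ → E →L[ℝ] E} {u : ℝ → E} {p : ℝ≥0∞}
    {a b : ℝ} (hu : MemLp u p (volume.restrict (Icc a b))) (hA : ContinuousOn A (Icc a b)) :
    MemLp (fun t => A t (u t)) p (volume.restrict (Icc a b)) := by
  obtain ⟨C, hC⟩ := isCompact_Icc.exists_bound_of_continuousOn hA
  refine hu.of_le_mul (c := C) ((ContinuousLinearMap.id ℝ (E →L[ℝ] E)).aestronglyMeasurable_comp₂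
    (hA.aestronglyMeasurable_of_isCompact isCompact_Icc measurableSet_Icc)
      hu.aestronglyMeasurable) ?_
  filter_upwards [ae_restrict_mem measurableSet_Icc] with t ht
  exact (A t).le_of_opNorm_le (hC t ht) _

theorem IntervalIntegrable.clm_apply_continuousOn {A : ℝ → E →L[ℝ] E} {u : ℝ → E} {a b : ℝ}
    (hab : a ≤ b) (hu : IntervalIntegrable u volume a b) (hA : ContinuousOn A (Icc a b)) :
    IntervalIntegrable (fun t => A t (u t)) volume a b := by
  rw [intervalIntegrable_iff_integrableOn_Icc_of_le hab, IntegrableOn, ← memLp_one_iff_integrable]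
    at hu ⊢
  exact hu.clm_apply_continuousOn hA

/-- `P` is an arc of the perturbed system `ẋ = f(x, t) + u(t)` on `[t₀, T]`, where the
perturbation `u` is integrable. -/
structure IsPerturbedArc (f : E → ℝ → E) (u : ℝ → E) (t₀ T : ℝ) (P : ℝ → E) : Prop where
  intervalIntegrable : IntervalIntegrable u volume t₀ T
  continuousOn : ContinuousOn P (Icc t₀ T)
  sub_eq : ∀ s ∈ Icc t₀ T, ∀ t ∈ Icc s T, P t - P s = ∫ τ in s..t, (f (P τ) τ + u τ)

variable {f : E → ℝ → E}

/-- A primitive is continuous, so `f` along `P` is continuous; subtracting it from the integrable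
velocity shows that the disturbance alone is integrable. -/
theorem isPerturbedArc_of_integral (hf : ContinuousOn (Function.uncurry f) (univ ×ˢ Ici 0))
    {d : E → ℝ → E} {t₀ T : ℝ} (ht₀ : 0 ≤ t₀) (hT : t₀ ≤ T) {P : ℝ → E}
    (hP : ∀ t ∈ Icc t₀ T, IntervalIntegrable (fun s => f (P s) s + d (P s) s) volume t₀ t ∧
      P t = P t₀ + ∫ s in t₀..t, (f (P s) s + d (P s) s)) :
    IsPerturbedArc f (fun t => d (P t) t) t₀ T P := by
  have hi := (hP T ⟨hT, le_rfl⟩).1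
  have hc : ContinuousOn P (Icc t₀ T) := by
    have h := (intervalIntegral.continuousOn_primitive_interval' hi left_mem_uIcc)
    rw [uIcc_of_le hT] at h
    exact (continuousOn_const.add h).congr fun t ht => (hP t ht).2
  refine ⟨?_, hc, fun s hs t ht => ?_⟩
  · have hfi : IntervalIntegrable (fun s => f (P s) s) volume t₀ T :=
      (continuousOn_comp_curve hf (Icc_subset_Ici_zero T ht₀) hc).intervalIntegrable_of_Icc hT
    simpa using hi.sub hfi
  · rw [(hP t ⟨hs.1.trans ht.1, ht.2⟩).2, (hP s hs).2, add_sub_add_left_eq_sub,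
      intervalIntegral.integral_interval_sub_left (hP t ⟨hs.1.trans ht.1, ht.2⟩).1 (hP s hs).1]

end ContinuousCoefficients

/-! ### Local Euler errors, summation over steps, and the robust contraction estimate -/

section BasicEstimate

variable {E : Type*} [NormedAddCommGroup E] [InnerProductSpace ℝ E] [FiniteDimensional ℝ E]
  [CompleteSpace E] {f : E → ℝ → E} {Θ : E → ℝ → E →L[ℝ] E} {lam m : ℝ} {u : ℝ → E}

/-- The local error of an Euler step from a perturbed arc: to first order, it is the weighted size
of the perturbation at the arc. -/
theorem IsPerturbedArc.exists_pathDist_euler_error_le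
    (hf : ContinuousOn (Function.uncurry f) (univ ×ˢ Ici 0))
    (hΘ : ContinuousOn (Function.uncurry Θ) (univ ×ˢ Ici 0)) {t₀ T : ℝ} (ht₀ : 0 ≤ t₀)
    {P : ℝ → E} (hP : IsPerturbedArc f u t₀ T P) {ε : ℝ} (hε : 0 < ε) :
    ∃ δ > 0, ∀ t h, t₀ ≤ t → 0 ≤ h → t + h ≤ T → h ≤ δ →
      pathDist (fun z => Θ z (t + h)) (P t + h • f (P t) t) (P (t + h)) ≤
        ∫ τ in t..(t + h), (‖Θ (P τ) τ (u τ)‖ + ε * (‖u τ‖ + 1)) := by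
  have hI := Icc_subset_Ici_zero T ht₀
  have hfP := continuousOn_comp_curve hf hI hP.continuousOn
  have hΘP := continuousOn_comp_curve hΘ hI hP.continuousOn
  obtain ⟨r, hr⟩ := isCompact_Icc.exists_bound_of_continuousOn hP.continuousOn
  obtain ⟨Cf, hCf⟩ := isCompact_Icc.exists_bound_of_continuousOn hfP
  have hB : IsCompact (Metric.closedBall (0 : E) (r + 1) ×ˢ Icc t₀ T) :=
    (isCompact_closedBall _ _).prod isCompact_Icc
  have hΘB := hΘ.mono (show Metric.closedBall (0 : E) (r + 1) ×ˢ Icc t₀ T ⊆ univ ×ˢ Ici 0 from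
    fun q hq => ⟨trivial, hI hq.2⟩)
  obtain ⟨C, hC⟩ := hB.exists_bound_of_continuousOn hΘB
  have ucΘ := Metric.uniformContinuousOn_iff.1 (hB.uniformContinuousOn_of_continuous hΘB)
  have ucf := Metric.uniformContinuousOn_iff.1
    (isCompact_Icc.uniformContinuousOn_of_continuous hfP)
  have ucP := Metric.uniformContinuousOn_iff.1
    (isCompact_Icc.uniformContinuousOn_of_continuous hP.continuousOn)
  obtain ⟨δ₁, hδ₁, H₁⟩ := ucΘ ε hε
  obtain ⟨δ₂, hδ₂, H₂⟩ := ucf (ε / (|C| + 1)) (by positivity)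
  obtain ⟨δ₃, hδ₃, H₃⟩ := ucP (min (δ₁ / 2) 1) (by positivity)
  -- These bounds keep the arc over one step, the Euler point and the segment between them close
  -- enough to `P t` for the uniform continuity of `Θ` and of `f` along `P`.
  refine ⟨min (min (δ₁ / 2) (δ₂ / 2)) (min (δ₃ / 2) (min (δ₁ / 2) 1 / (|Cf| + 1))), by positivity,
    fun t h ht hh hT hδ => ?_⟩
  rw [le_min_iff, le_min_iff, le_min_iff] at hδ
  obtain ⟨⟨k₁, k₂⟩, k₃, k₄⟩ := hδ
  have htI : t ∈ Icc t₀ T := ⟨ht, by linarith⟩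
  have hthI : t + h ∈ Icc t₀ T := ⟨by linarith, hT⟩
  have hsub : Icc t (t + h) ⊆ Icc t₀ T := Icc_subset_Icc ht hT
  have hle : t ≤ t + h := by linarith
  have hu : IntervalIntegrable u volume t (t + h) :=
    intervalIntegrable_of_mem_Icc hP.intervalIntegrable htI ⟨hle, hT⟩
  have hfi : IntervalIntegrable (fun τ => f (P τ) τ) volume t (t + h) :=
    (hfP.mono hsub).intervalIntegrable_of_Icc hle
  have hsmall : ‖h • f (P t) t‖ ≤ min (δ₁ / 2) 1 := by
    rw [norm_smul, Real.norm_eq_abs, abs_of_nonneg hh]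
    rw [le_div_iff₀ (by positivity)] at k₄
    refine le_trans (mul_le_mul_of_nonneg_left ?_ hh) k₄
    exact (hCf t htI).trans ((le_abs_self _).trans (by linarith))
  have hPτ : ∀ τ ∈ Icc t (t + h), ‖P τ - P t‖ < min (δ₁ / 2) 1 := fun τ hτ => by
    rw [← dist_eq_norm]
    refine H₃ _ (hsub hτ) _ htI ?_
    rw [Real.dist_eq, abs_of_nonneg (by linarith [hτ.1])]
    linarith [hτ.2]
  set e := P (t + h) - (P t + h • f (P t) t) with he
  have hee : e = ∫ τ in t..(t + h), (f (P τ) τ - f (P t) t + u τ) := by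
    have h1 := hP.sub_eq t htI (t + h) ⟨hle, hT⟩
    have h2 : ∫ τ in t..(t + h), f (P t) t = h • f (P t) t := by simp
    rw [he, ← sub_sub, h1, ← h2,
      ← intervalIntegral.integral_sub (hfi.add hu) intervalIntegrable_const]
    congr 1; ext τ; abel
  -- The error is joined by a straight segment. Its points `z` are convex combinations of the Euler
  -- point and `P (t + h)`, so `Θ z (t + h)` is within `ε` of `Θ (P τ) τ` throughout the step.
  refine pathDist_le_of_segment _ _ _ fun σ hσ => ?_
  rw [← he]
  set z := P t + h • f (P t) t + σ • e with hz
  have hzt : ‖z - P t‖ ≤ min (δ₁ / 2) 1 := by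
    have : z - P t = (1 - σ) • (h • f (P t) t) + σ • (P (t + h) - P t) := by
      rw [hz, he, smul_sub, smul_add, sub_smul, one_smul, smul_sub]; abel
    rw [this]
    refine (norm_add_le _ _).trans ?_
    rw [norm_smul (1 - σ), norm_smul σ, Real.norm_of_nonneg hσ.1, Real.norm_of_nonneg (by linarith [hσ.2])]
    have h1 := mul_le_mul_of_nonneg_left hsmall (show 0 ≤ 1 - σ by linarith [hσ.2])
    have h2 := mul_le_mul_of_nonneg_left (hPτ (t + h) ⟨hle, le_rfl⟩).le hσ.1
    linarith
  have hzB : (z, t + h) ∈ Metric.closedBall (0 : E) (r + 1) ×ˢ Icc t₀ T := by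
    refine ⟨?_, hthI⟩
    rw [mem_closedBall_zero_iff]
    calc ‖z‖ = ‖P t + (z - P t)‖ := by rw [add_sub_cancel]
      _ ≤ r + 1 := (norm_add_le _ _).trans (add_le_add (hr t htI) (hzt.trans (min_le_right _ _)))
  have hCz : ‖Θ z (t + h)‖ ≤ |C| := (hC _ hzB).trans (le_abs_self _)
  have hΘz : ∀ τ ∈ Icc t (t + h), ‖Θ z (t + h) - Θ (P τ) τ‖ ≤ ε := fun τ hτ => by
    rw [← dist_eq_norm]
    refine (H₁ (z, t + h) hzB (P τ, τ) ⟨?_, hsub hτ⟩ ?_).le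
    · rw [mem_closedBall_zero_iff]
      linarith [hr τ (hsub hτ)]
    · rw [Prod.dist_eq, max_lt_iff]
      constructor
      · calc dist z (P τ) ≤ dist z (P t) + dist (P t) (P τ) := dist_triangle _ _ _
          _ < δ₁ / 2 + δ₁ / 2 := by
            refine add_lt_add_of_le_of_lt ?_ ?_
            · rw [dist_eq_norm]; exact hzt.trans (min_le_left _ _)
            · rw [dist_comm, dist_eq_norm]; exact (hPτ τ hτ).trans_le (min_le_left _ _)
          _ = δ₁ := add_halves _
      · rw [Real.dist_eq, abs_of_nonneg (by linarith [hτ.2])]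
        linarith [hτ.1]
  have hint : IntervalIntegrable (fun τ => ‖Θ (P τ) τ (u τ)‖ + ε * (‖u τ‖ + 1)) volume
      t (t + h) :=
    (hu.clm_apply_continuousOn hle (hΘP.mono hsub)).norm.add
      ((hu.norm.add intervalIntegrable_const).const_mul ε)
  rw [hee, ← ContinuousLinearMap.intervalIntegral_comp_comm _
    ((hfi.sub intervalIntegrable_const).add hu)]
  refine intervalIntegral.norm_integral_le_of_norm_le hle (Eventually.of_forall fun τ hτ => ?_) hint
  have hτ' : τ ∈ Icc t (t + h) := ⟨hτ.1.le, hτ.2⟩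
  have hfd : ‖f (P τ) τ - f (P t) t‖ ≤ ε / (|C| + 1) := by
    rw [← dist_eq_norm]
    refine (H₂ _ (hsub hτ') _ htI ?_).le
    rw [Real.dist_eq, abs_of_nonneg (by linarith [hτ'.1])]
    linarith [hτ'.2]
  have h1 : ‖Θ z (t + h) (f (P τ) τ - f (P t) t)‖ ≤ ε := by
    refine (ContinuousLinearMap.le_of_opNorm_le _ hCz _).trans ?_
    calc |C| * ‖f (P τ) τ - f (P t) t‖ ≤ (|C| + 1) * (ε / (|C| + 1)) := by
          gcongr
          linarith
      _ = ε := by field_simp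
  have h2 : ‖(Θ z (t + h) - Θ (P τ) τ) (u τ)‖ ≤ ε * ‖u τ‖ :=
    ContinuousLinearMap.le_of_opNorm_le _ (hΘz τ hτ') _
  -- Only the first term survives to first order; the others are errors from freezing `Θ` and `f`,
  -- bounded by `ε ‖u τ‖` and `ε`.
  have h3 : Θ z (t + h) (f (P τ) τ - f (P t) t + u τ) = Θ (P τ) τ (u τ) +
      (Θ z (t + h) - Θ (P τ) τ) (u τ) + Θ z (t + h) (f (P τ) τ - f (P t) t) := by
    rw [map_add, sub_apply]; abel
  rw [h3]
  refine (norm_add₃_le).trans ?_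
  linarith

omit [CompleteSpace E] in
/-- The smallest path integral between two continuous curves is bounded on compact intervals. -/
theorem exists_pathDist_le (hΘ : ContinuousOn (Function.uncurry Θ) (univ ×ˢ Ici 0)) {t₀ T : ℝ}
    (ht₀ : 0 ≤ t₀) {P₁ P₂ : ℝ → E} (h₁ : ContinuousOn P₁ (Icc t₀ T))
    (h₂ : ContinuousOn P₂ (Icc t₀ T)) :
    ∃ L, ∀ t ∈ Icc t₀ T, pathDist (fun z => Θ z t) (P₁ t) (P₂ t) ≤ L := by
  obtain ⟨r₁, hr₁⟩ := isCompact_Icc.exists_bound_of_continuousOn h₁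
  obtain ⟨r₂, hr₂⟩ := isCompact_Icc.exists_bound_of_continuousOn h₂
  have hB : IsCompact (Metric.closedBall (0 : E) (r₁ + (r₁ + r₂)) ×ˢ Icc t₀ T) :=
    (isCompact_closedBall _ _).prod isCompact_Icc
  obtain ⟨C, hC⟩ := hB.exists_bound_of_continuousOn
    (hΘ.mono fun q hq => ⟨trivial, Icc_subset_Ici_zero T ht₀ hq.2⟩)
  refine ⟨|C| * (r₁ + r₂), fun t ht => pathDist_le_of_segment _ _ _ fun s hs => ?_⟩
  have hd : ‖P₂ t - P₁ t‖ ≤ r₁ + r₂ :=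
    (norm_sub_le _ _).trans (by linarith [hr₁ t ht, hr₂ t ht])
  refine (ContinuousLinearMap.le_of_opNorm_le _ ((hC (_, t) ⟨?_, ht⟩).trans (le_abs_self C))
    _).trans (by gcongr)
  rw [mem_closedBall_zero_iff]
  refine (norm_add_le _ _).trans (add_le_add (hr₁ t ht) ?_)
  rw [norm_smul, Real.norm_of_nonneg hs.1]
  nlinarith [norm_nonneg (P₂ t - P₁ t), hs.2, hs.1]

/-- The estimate for the smallest path integral in terms of the perturbation, with a loss `ε` in the
rate, obtained from finitely many Euler steps. -/
theorem IsContracting.exp_mul_pathDist_le_of_pos (hc : IsContracting f Θ lam m) {t₀ T : ℝ}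
    (ht₀ : 0 ≤ t₀) (hT : t₀ ≤ T) {P₁ P₂ : ℝ → E} (h₁ : IsPerturbedArc f 0 t₀ T P₁)
    (h₂ : IsPerturbedArc f u t₀ T P₂) {ε : ℝ} (hε : 0 < ε) (hεl : ε ≤ lam) :
    Real.exp ((lam - ε) * T) * pathDist (fun z => Θ z T) (P₁ T) (P₂ T) ≤
      Real.exp ((lam - ε) * t₀) * pathDist (fun z => Θ z t₀) (P₁ t₀) (P₂ t₀) +
      Real.exp (lam * ε) * ∫ τ in t₀..T,
        Real.exp ((lam - ε) * τ) * (‖Θ (P₂ τ) τ (u τ)‖ + ε * (‖u τ‖ + 2)) := by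
  have hfc := hc.contDiffOn_field.continuousOn
  have hΘc := hc.contDiffOn_factor.continuousOn
  obtain ⟨L, hL⟩ := exists_pathDist_le hΘc ht₀ h₁.continuousOn h₂.continuousOn
  obtain ⟨r, hr⟩ := isCompact_Icc.exists_bound_of_continuousOn h₁.continuousOn
  obtain ⟨δ₁, hδ₁, H₁⟩ := h₁.exists_pathDist_euler_error_le hfc hΘc ht₀ hε
  obtain ⟨δ₂, hδ₂, H₂⟩ := h₂.exists_pathDist_euler_error_le hfc hΘc ht₀ hε
  obtain ⟨δ₃, hδ₃, H₃⟩ := hc.exists_pathDist_euler_le r L T hε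
  -- Including `ε` gives `h ≤ ε`, hence `exp (μ h) ≤ exp (lam ε)`, which is the factor before the
  -- integral.
  set δ := min (min δ₁ δ₂) (min δ₃ ε) with hδ
  have hδpos : 0 < δ := by positivity
  obtain ⟨N, hN⟩ := exists_nat_gt ((T - t₀) / δ)
  have hN0 : (0 : ℝ) < N := lt_of_le_of_lt (div_nonneg (by linarith) hδpos.le) hN
  set h := (T - t₀) / N with hh
  have hh0 : 0 ≤ h := div_nonneg (by linarith) hN0.le
  have hhδ : h ≤ δ := by
    rw [div_lt_iff₀ hδpos] at hN
    rw [hh, div_le_iff₀ hN0]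
    linarith
  rw [hδ, le_min_iff, le_min_iff, le_min_iff] at hhδ
  obtain ⟨⟨k₁, k₂⟩, k₃, k₄⟩ := hhδ
  set μ := lam - ε with hμ
  have hμ0 : 0 ≤ μ := by linarith
  set R : ℝ → ℝ := fun t => pathDist (fun z => Θ z t) (P₁ t) (P₂ t) with hR
  -- The constant 2 adds the `ε` errors of both arcs; for `P₁`, whose perturbation is zero, that is
  -- the only contribution.
  set G : ℝ → ℝ := fun τ => ‖Θ (P₂ τ) τ (u τ)‖ + ε * (‖u τ‖ + 2) with hG
  have hGi : IntervalIntegrable G volume t₀ T :=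
    (h₂.intervalIntegrable.clm_apply_continuousOn hT (continuousOn_comp_curve hΘc
      (Icc_subset_Ici_zero T ht₀) h₂.continuousOn)).norm.add
      ((h₂.intervalIntegrable.norm.add intervalIntegrable_const).const_mul ε)
  have hGe : IntervalIntegrable (fun τ => Real.exp (μ * τ) * G τ) volume t₀ T :=
    hGi.continuousOn_mul (by fun_prop)
  have hG0 : ∀ τ, 0 ≤ G τ := fun τ => by positivity
  have step : ∀ t, t₀ ≤ t → t + h ≤ T →
      R (t + h) ≤ Real.exp (-μ * h) * R t + ∫ τ in t..(t + h), G τ := fun t ht hth => by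
    have htI : t ∈ Icc t₀ T := ⟨ht, by linarith⟩
    have hle : t ≤ t + h := by linarith
    have hW : Continuous fun z => Θ z (t + h) :=
      continuous_slice hc.contDiffOn_factor (by linarith)
    have e₁ := H₁ t h ht hh0 hth k₁
    have e₂ := H₂ t h ht hh0 hth k₂
    have e₃ := H₃ t ⟨by linarith, by linarith⟩ h ⟨hh0, k₃⟩ (P₁ t) (P₂ t) (hr t htI) (hL t htI)
    rw [show -lam + ε = -μ by rw [hμ]; ring] at e₃
    rw [pathDist_comm hW] at e₁
    have t₁ := pathDist_triangle hW (P₁ (t + h)) (P₁ t + h • f (P₁ t) t) (P₂ (t + h))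
    have t₂ := pathDist_triangle hW (P₁ t + h • f (P₁ t) t) (P₂ t + h • f (P₂ t) t) (P₂ (t + h))
    have hu' : IntervalIntegrable u volume t (t + h) :=
      intervalIntegrable_of_mem_Icc h₂.intervalIntegrable htI ⟨hle, hth⟩
    have hΘu : IntervalIntegrable (fun τ => Θ (P₂ τ) τ (u τ)) volume t (t + h) :=
      hu'.clm_apply_continuousOn hle (continuousOn_comp_curve hΘc
        (fun s hs => by have := hs.1; exact mem_Ici.2 (by linarith))
        (h₂.continuousOn.mono (Icc_subset_Icc ht hth)))
    have hsum : (∫ τ in t..(t + h), (‖Θ (P₁ τ) τ ((0 : ℝ → E) τ)‖ +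
        ε * (‖(0 : ℝ → E) τ‖ + 1))) +
        ∫ τ in t..(t + h), (‖Θ (P₂ τ) τ (u τ)‖ + ε * (‖u τ‖ + 1)) =
        ∫ τ in t..(t + h), G τ := by
      simp only [Pi.zero_apply, map_zero, norm_zero, zero_add, mul_one]
      rw [← intervalIntegral.integral_add intervalIntegrable_const
        (hΘu.norm.add ((hu'.norm.add intervalIntegrable_const).const_mul ε))]
      refine intervalIntegral.integral_congr fun τ _ => ?_
      simp only [hG]; ring
    rw [← hsum]
    simp only [hR]
    linarith
  -- With the weight `exp (μ t)` the one-step contraction factor cancels, and the recursion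
  -- telescopes.
  have ind : ∀ k : ℕ, k ≤ N → Real.exp (μ * (t₀ + k * h)) * R (t₀ + k * h) ≤
      Real.exp (μ * t₀) * R t₀ +
        Real.exp (lam * ε) * ∫ τ in t₀..(t₀ + k * h), Real.exp (μ * τ) * G τ := by
    intro k
    induction k with
    | zero => intro _; simp
    | succ k ih =>
      intro hk
      have hkN : ((k : ℝ) + 1) ≤ N := by exact_mod_cast hk
      have ih := ih (by omega)
      set t := t₀ + k * h with ht
      have hts : t₀ + ((k + 1 : ℕ) : ℝ) * h = t + h := by rw [ht]; push_cast; ring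
      rw [hts]
      have htt : t₀ ≤ t := by rw [ht]; have : (0 : ℝ) ≤ k * h := by positivity
                              linarith
      have hth : t + h ≤ T := by
        have h1 : ((k : ℝ) + 1) * h ≤ N * h := mul_le_mul_of_nonneg_right hkN hh0
        have h2 : (N : ℝ) * h = T - t₀ := by rw [hh]; field_simp
        rw [ht]; linarith
      have hle : t ≤ t + h := by linarith
      have htI : t ∈ Icc t₀ T := ⟨htt, by linarith⟩
      have i₁ := intervalIntegrable_of_mem_Icc hGe ⟨le_rfl, hT⟩ ⟨htt, htI.2⟩
      have i₂ := intervalIntegrable_of_mem_Icc hGe htI ⟨hle, hth⟩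
      have i₃ := intervalIntegrable_of_mem_Icc hGi htI ⟨hle, hth⟩
      rw [← intervalIntegral.integral_add_adjacent_intervals i₁ i₂,
        mul_add (Real.exp (lam * ε)), ← add_assoc]
      -- The endpoint weight is moved under the integral: `t ≤ τ` costs at most a factor `exp (μ
      -- h)`.
      have hI : Real.exp (μ * (t + h)) * ∫ τ in t..(t + h), G τ ≤
          Real.exp (lam * ε) * ∫ τ in t..(t + h), Real.exp (μ * τ) * G τ := by
        rw [← intervalIntegral.integral_const_mul, ← intervalIntegral.integral_const_mul]
        refine intervalIntegral.integral_mono_on hle (i₃.const_mul _) (i₂.const_mul _)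
          fun τ hτ => ?_
        rw [← mul_assoc, ← Real.exp_add]
        refine mul_le_mul_of_nonneg_right (Real.exp_le_exp.2 ?_) (hG0 τ)
        have h1 : μ * (t + h) ≤ μ * (τ + h) := by gcongr; exact hτ.1
        have h2 : μ * h ≤ lam * ε := mul_le_mul (by linarith) k₄ hh0 (by linarith)
        linarith
      have hs := mul_le_mul_of_nonneg_left (step t htt hth) (Real.exp_pos (μ * (t + h))).le
      rw [mul_add (Real.exp _), ← mul_assoc, ← Real.exp_add,
        show μ * (t + h) + -μ * h = μ * t by ring] at hs
      linarith
  have hfin := ind N le_rfl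
  rwa [show t₀ + (N : ℝ) * h = T by rw [hh]; field_simp; ring] at hfin

/-- Robust contraction: the smallest path integral between an arc of the contracting system and an
arc of the perturbed system. -/
theorem IsContracting.pathDist_le (hc : IsContracting f Θ lam m) {t₀ T : ℝ}
    (ht₀ : 0 ≤ t₀) (hT : t₀ ≤ T) {P₁ P₂ : ℝ → E} (h₁ : IsPerturbedArc f 0 t₀ T P₁)
    (h₂ : IsPerturbedArc f u t₀ T P₂) :
    pathDist (fun z => Θ z T) (P₁ T) (P₂ T) ≤
      Real.exp (-lam * (T - t₀)) * pathDist (fun z => Θ z t₀) (P₁ t₀) (P₂ t₀) +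
      ∫ τ in t₀..T, Real.exp (-lam * (T - τ)) * ‖Θ (P₂ τ) τ (u τ)‖ := by
  have hΘc := hc.contDiffOn_factor.continuousOn
  have hΘu := h₂.intervalIntegrable.clm_apply_continuousOn hT (continuousOn_comp_curve hΘc
      (Icc_subset_Ici_zero T ht₀) h₂.continuousOn)
  have hexp : ContinuousOn (fun τ => Real.exp (lam * τ)) (uIcc t₀ T) := by fun_prop
  have i₁ : IntervalIntegrable (fun τ => Real.exp (lam * τ) * ‖Θ (P₂ τ) τ (u τ)‖) volume t₀ T :=
    hΘu.norm.continuousOn_mul hexp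
  have i₂ : IntervalIntegrable (fun τ => Real.exp (lam * τ) * (‖u τ‖ + 2)) volume t₀ T :=
    (h₂.intervalIntegrable.norm.add intervalIntegrable_const).continuousOn_mul hexp
  set RT := pathDist (fun z => Θ z T) (P₁ T) (P₂ T)
  set R₀ := pathDist (fun z => Θ z t₀) (P₁ t₀) (P₂ t₀)
  set I := ∫ τ in t₀..T, Real.exp (lam * τ) * ‖Θ (P₂ τ) τ (u τ)‖ with hI
  set J := ∫ τ in t₀..T, Real.exp (lam * τ) * (‖u τ‖ + 2) with hJ
  have hR₀ : 0 ≤ R₀ := pathDist_nonneg _ _ _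
  -- On the right `lam - ε` can be raised to `lam` since all times are nonnegative, so that `ε`
  -- leaves the integrands and the limit is one of continuous functions of `ε`.
  have key : ∀ ε ∈ Ioc 0 lam, Real.exp ((lam - ε) * T) * RT ≤
      Real.exp (lam * t₀) * R₀ + Real.exp (lam * ε) * (I + ε * J) := fun ε hε => by
    refine (hc.exp_mul_pathDist_le_of_pos ht₀ hT h₁ h₂ hε.1 hε.2).trans ?_
    have hexpε : ContinuousOn (fun τ => Real.exp ((lam - ε) * τ)) (uIcc t₀ T) := by fun_prop
    refine add_le_add ?_ (mul_le_mul_of_nonneg_left ?_ (Real.exp_pos _).le)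
    · refine mul_le_mul_of_nonneg_right (Real.exp_le_exp.2 ?_) hR₀
      nlinarith [hε.1]
    · rw [hI, hJ, ← intervalIntegral.integral_const_mul,
        ← intervalIntegral.integral_add i₁ (i₂.const_mul ε)]
      refine intervalIntegral.integral_mono_on hT ((hΘu.norm.add
        ((h₂.intervalIntegrable.norm.add intervalIntegrable_const).const_mul ε)).continuousOn_mul
          hexpε) (i₁.add (i₂.const_mul ε)) fun τ hτ => ?_
      have h1 : Real.exp ((lam - ε) * τ) ≤ Real.exp (lam * τ) := by
        refine Real.exp_le_exp.2 ?_
        nlinarith [hε.1, hτ.1]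
      have h2 : 0 ≤ ‖Θ (P₂ τ) τ (u τ)‖ + ε * (‖u τ‖ + 2) := by have := hε.1; positivity
      calc _ ≤ Real.exp (lam * τ) * (‖Θ (P₂ τ) τ (u τ)‖ + ε * (‖u τ‖ + 2)) :=
            mul_le_mul_of_nonneg_right h1 h2
        _ = _ := by ring
  have hev : ∀ᶠ ε in 𝓝[>] (0 : ℝ), Real.exp ((lam - ε) * T) * RT ≤
      Real.exp (lam * t₀) * R₀ + Real.exp (lam * ε) * (I + ε * J) := by
    filter_upwards [Ioc_mem_nhdsGT hc.rate_pos] with ε hε using key ε hε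
  have l₁ : Tendsto (fun ε : ℝ => Real.exp ((lam - ε) * T) * RT) (𝓝[>] 0)
      (𝓝 (Real.exp ((lam - 0) * T) * RT)) :=
    ((by fun_prop : Continuous fun ε : ℝ => Real.exp ((lam - ε) * T) * RT).tendsto 0).mono_left
      nhdsWithin_le_nhds
  have l₂ : Tendsto (fun ε : ℝ => Real.exp (lam * t₀) * R₀ + Real.exp (lam * ε) * (I + ε * J))
      (𝓝[>] 0) (𝓝 (Real.exp (lam * t₀) * R₀ + Real.exp (lam * 0) * (I + 0 * J))) :=
    ((by fun_prop : Continuous fun ε : ℝ =>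
      Real.exp (lam * t₀) * R₀ + Real.exp (lam * ε) * (I + ε * J)).tendsto 0).mono_left
      nhdsWithin_le_nhds
  have hfin := le_of_tendsto_of_tendsto l₁ l₂ hev
  simp only [sub_zero, mul_zero, Real.exp_zero, zero_mul, add_zero, one_mul] at hfin
  have hmul := mul_le_mul_of_nonneg_left hfin (Real.exp_pos (-lam * T)).le
  rw [← mul_assoc, ← Real.exp_add, show -lam * T + lam * T = 0 by ring, Real.exp_zero, one_mul,
    mul_add, ← mul_assoc, ← Real.exp_add, hI, ← intervalIntegral.integral_const_mul] at hmul
  refine hmul.trans (le_of_eq ?_)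
  congr 1
  · congr 2; ring
  · refine intervalIntegral.integral_congr fun τ _ => ?_
    rw [← mul_assoc, ← Real.exp_add]
    congr 2; ring

end BasicEstimate

/-! ### Solutions on a compact interval from an a priori bound -/

section GlobalExistence

variable {E : Type*} [NormedAddCommGroup E] [NormedSpace ℝ E]

/-- The radial retraction onto the closed ball of radius `r` about the origin. -/
noncomputable def radialRetract (r : ℝ) (x : E) : E := (r / max r ‖x‖) • x

theorem radialRetract_of_norm_le {r : ℝ} (hr : 0 < r) {x : E} (hx : ‖x‖ ≤ r) :
    radialRetract r x = x := by
  rw [radialRetract, max_eq_left hx, div_self hr.ne', one_smul]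

theorem norm_radialRetract_le {r : ℝ} (hr : 0 < r) (x : E) : ‖radialRetract r x‖ ≤ r := by
  have hM : 0 < max r ‖x‖ := lt_max_of_lt_left hr
  rw [radialRetract, norm_smul, Real.norm_of_nonneg (by positivity), div_mul_eq_mul_div,
    div_le_iff₀ hM]
  exact mul_le_mul_of_nonneg_left (le_max_right _ _) hr.le

/-- With `a = max r ‖x‖` and `b = max r ‖y‖`, the difference is `(r / a)(x - y)` plus a multiple of
`y` of norm at most `|b - a|`; each part is at most `‖x - y‖`. -/
theorem lipschitzWith_radialRetract {r : ℝ} (hr : 0 < r) :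
    LipschitzWith 2 (radialRetract r : E → E) := by
  refine LipschitzWith.of_dist_le_mul fun x y => ?_
  rw [dist_eq_norm, dist_eq_norm, NNReal.coe_ofNat]
  set a := max r ‖x‖ with ha
  set b := max r ‖y‖ with hb
  have hra : r ≤ a := le_max_left _ _
  have hya : ‖y‖ ≤ b := le_max_right _ _
  have ha0 : 0 < a := hr.trans_le hra
  have hb0 : 0 < b := hr.trans_le (le_max_left _ _)
  have hab : |b - a| ≤ ‖x - y‖ := by
    rw [hb, ha]
    refine (abs_max_sub_max_le_max r ‖y‖ r ‖x‖).trans ?_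
    rw [sub_self, abs_zero, norm_sub_rev]
    exact max_le (norm_nonneg _) (abs_norm_sub_norm_le _ _)
  have hdec : radialRetract r x - radialRetract r y =
      (r / a) • (x - y) + (r / a * ((b - a) / b)) • y := by
    have : r / a * ((b - a) / b) = r / a - r / b := by field_simp
    rw [this, radialRetract, radialRetract, smul_sub, sub_smul, ← ha, ← hb]
    abel
  rw [hdec]
  refine (norm_add_le _ _).trans ?_
  have hra1 : r / a ≤ 1 := (div_le_one ha0).2 hra
  have hra0 : 0 ≤ r / a := by positivity
  rw [norm_smul, norm_smul, norm_mul, norm_div (b - a), Real.norm_of_nonneg hra0,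
    Real.norm_of_nonneg hb0.le, Real.norm_eq_abs]
  have h1 : r / a * ‖x - y‖ ≤ ‖x - y‖ := mul_le_of_le_one_left (norm_nonneg _) hra1
  have h2 : r / a * (|b - a| / b) * ‖y‖ ≤ ‖x - y‖ := by
    calc r / a * (|b - a| / b) * ‖y‖ ≤ 1 * (|b - a| / b) * b := by gcongr
      _ = |b - a| := by field_simp
      _ ≤ ‖x - y‖ := hab
  linarith

/-- `x` is a differentiable solution of `ẋ = g(x, t)` on `[t₀, T]`. -/
def IsSolutionOn (g : E → ℝ → E) (t₀ T : ℝ) (x : ℝ → E) : Prop :=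
  ∀ t ∈ Icc t₀ T, HasDerivWithinAt x (g (x t) t) (Icc t₀ T) t

variable {g : E → ℝ → E} {t₀ T : ℝ} {x : ℝ → E}

theorem IsSolutionOn.continuousOn (hx : IsSolutionOn g t₀ T x) : ContinuousOn x (Icc t₀ T) :=
  fun t ht => (hx t ht).continuousWithinAt

theorem IsSolutionOn.mono (hx : IsSolutionOn g t₀ T x) {τ : ℝ} (hτ : τ ≤ T) :
    IsSolutionOn g t₀ τ x := fun t ht =>
  (hx t ⟨ht.1, ht.2.trans hτ⟩).mono (Icc_subset_Icc_right hτ)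

theorem IsSolutionOn.hasDerivWithinAt_Ici (hx : IsSolutionOn g t₀ T x) {t : ℝ}
    (ht : t ∈ Ico t₀ T) : HasDerivWithinAt x (g (x t) t) (Ici t) t :=
  ((hx t ⟨ht.1, ht.2.le⟩).mono (Icc_subset_Icc_left ht.1)).mono_of_mem_nhdsWithin
    (Icc_mem_nhdsGE ht.2)

theorem IsSolutionOn.integral_eq [CompleteSpace E] (hx : IsSolutionOn g t₀ T x)
    (hg : ContinuousOn (Function.uncurry g) (univ ×ˢ Ici t₀)) {t : ℝ} (ht : t ∈ Icc t₀ T) :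
    IntervalIntegrable (fun s => g (x s) s) volume t₀ t ∧
      x t = x t₀ + ∫ s in t₀..t, g (x s) s := by
  have hxt := hx.mono ht.2
  have hi : IntervalIntegrable (fun s => g (x s) s) volume t₀ t :=
    (hg.comp (hxt.continuousOn.prodMk continuousOn_id)
      fun s hs => ⟨trivial, hs.1⟩).intervalIntegrable_of_Icc ht.1
  refine ⟨hi, ?_⟩
  rw [intervalIntegral.integral_eq_sub_of_hasDerivAt_of_le ht.1 hxt.continuousOn
    (fun s hs => (hxt s ⟨hs.1.le, hs.2.le⟩).hasDerivAt (Icc_mem_nhds hs.1 hs.2)) hi,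
    add_sub_cancel]

/-- Both solutions stay in a common ball by compactness, and there the field is Lipschitz. -/
theorem IsSolutionOn.eqOn (hx : IsSolutionOn g t₀ T x) {y : ℝ → E} (hy : IsSolutionOn g t₀ T y)
    (hL : ∀ r : ℝ, ∃ K, ∀ t ∈ Icc t₀ T, LipschitzOnWith K (fun x => g x t) (Metric.ball 0 r))
    (h₀ : x t₀ = y t₀) : EqOn x y (Icc t₀ T) := by
  obtain ⟨r₁, hr₁⟩ := isCompact_Icc.exists_bound_of_continuousOn hx.continuousOn
  obtain ⟨r₂, hr₂⟩ := isCompact_Icc.exists_bound_of_continuousOn hy.continuousOn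
  obtain ⟨K, hK⟩ := hL (max r₁ r₂ + 1)
  refine ODE_solution_unique_of_mem_Icc_right (v := fun t x => g x t)
    (s := fun _ => Metric.ball 0 (max r₁ r₂ + 1)) (K := K)
    (fun t ht => hK t ⟨ht.1, ht.2.le⟩) hx.continuousOn
    (fun t ht => hx.hasDerivWithinAt_Ici ht) (fun t ht => ?_) hy.continuousOn
    (fun t ht => hy.hasDerivWithinAt_Ici ht) (fun t ht => ?_) h₀
  · rw [mem_ball_zero_iff]
    exact (hr₁ t ⟨ht.1, ht.2.le⟩).trans_lt ((le_max_left _ _).trans_lt (lt_add_one _))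
  · rw [mem_ball_zero_iff]
    exact (hr₂ t ⟨ht.1, ht.2.le⟩).trans_lt ((le_max_right _ _).trans_lt (lt_add_one _))

variable [FiniteDimensional ℝ E] [CompleteSpace E]

/-- Solutions exist on `[t₀, T]` if they satisfy an a priori bound. -/
theorem exists_isSolutionOn (hg : ContinuousOn (Function.uncurry g) (univ ×ˢ Ici t₀))
    (hL : ∀ r : ℝ, ∃ K, ∀ t ∈ Icc t₀ T, LipschitzOnWith K (fun x => g x t) (Metric.ball 0 r))
    (hT : t₀ ≤ T) (x₀ : E) {B : ℝ}
    (hB : ∀ τ ∈ Icc t₀ T, ∀ x : ℝ → E, x t₀ = x₀ → IsSolutionOn g t₀ τ x → ‖x τ‖ ≤ B) :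
    ∃ x : ℝ → E, x t₀ = x₀ ∧ IsSolutionOn g t₀ T x := by
  set r := |B| + ‖x₀‖ + 1 with hr
  have hr0 : 0 < r := by positivity
  have hBr : B < r := by rw [hr]; linarith [le_abs_self B, norm_nonneg x₀]
  obtain ⟨K, hK⟩ := hL (r + 1)
  have hcomp : IsCompact (Metric.closedBall (0 : E) r ×ˢ Icc t₀ T) :=
    (isCompact_closedBall _ _).prod isCompact_Icc
  obtain ⟨C, hC⟩ := hcomp.exists_bound_of_continuousOn
    (hg.mono fun q hq => ⟨trivial, hq.2.1⟩)
  have hretr : ∀ x : E, radialRetract r x ∈ Metric.closedBall (0 : E) r := fun x => by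
    rw [mem_closedBall_zero_iff]; exact norm_radialRetract_le hr0 x
  -- Composed with the retraction, the field is globally Lipschitz and bounded by `C` on the
  -- interval, so Picard–Lindelöf reaches all of `[t₀, T]`: the solution moves at most `C (T - t₀)`.
  have hPL : IsPicardLindelof (fun t x => g (radialRetract r x) t)
      (⟨t₀, le_rfl, hT⟩ : Icc t₀ T) x₀ (C.toNNReal * (T - t₀).toNNReal) 0 C.toNNReal (K * 2) := by
    refine ⟨fun t ht => ?_, fun x _ => ?_, fun t ht x _ => ?_, ?_⟩
    · refine LipschitzOnWith.mono (t := univ) ?_ (subset_univ _)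
      refine (hK t ht).comp (lipschitzWith_radialRetract hr0).lipschitzOnWith fun x _ => ?_
      exact Metric.closedBall_subset_ball (lt_add_one r) (hretr x)
    · exact hg.comp (by fun_prop : ContinuousOn (fun t => (radialRetract r x, t)) (Icc t₀ T))
        fun t ht => ⟨trivial, ht.1⟩
    · exact (hC (_, t) ⟨hretr x, ht⟩).trans (Real.le_coe_toNNReal C)
    · simp [Real.coe_toNNReal _ (sub_nonneg.2 hT), max_eq_left (sub_nonneg.2 hT)]
  obtain ⟨x, hx₀, hx⟩ := hPL.exists_eq_forall_mem_Icc_hasDerivWithinAt₀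
  have hxc : ContinuousOn x (Icc t₀ T) := fun t ht => (hx t ht).continuousWithinAt
  have hsol : ∀ τ ∈ Icc t₀ T, (∀ t ∈ Icc t₀ τ, ‖x t‖ ≤ r) → IsSolutionOn g t₀ τ x :=
    fun τ hτ hxr t ht => by
      have h := (hx t ⟨ht.1, ht.2.trans hτ.2⟩).mono (Icc_subset_Icc_right hτ.2)
      rwa [radialRetract_of_norm_le hr0 (hxr t ht)] at h
  -- Up to the first time `τ` with `‖x τ‖ ≥ r` the truncation is inactive, so `x` solves the
  -- original equation and satisfies `‖x τ‖ ≤ B < r`, a contradiction.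
  have hlt : ∀ t ∈ Icc t₀ T, ‖x t‖ ≤ r := by
    by_contra! hcon
    obtain ⟨t₁, ht₁, hlt₁⟩ := hcon
    have hclosed : IsClosed (Icc t₀ T ∩ (fun t => ‖x t‖) ⁻¹' Ici r) :=
      hxc.norm.preimage_isClosed_of_isClosed isClosed_Icc isClosed_Ici
    obtain ⟨τ, ⟨hτI, hτr⟩, hτmin⟩ := (isCompact_Icc.of_isClosed_subset hclosed
      inter_subset_left).exists_isLeast ⟨t₁, ht₁, hlt₁.le⟩
    have hbefore : ∀ t ∈ Ico t₀ τ, ‖x t‖ ≤ r := fun t ht => by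
      by_contra! h
      exact absurd (hτmin ⟨⟨ht.1, ht.2.le.trans hτI.2⟩, h.le⟩) (not_le.2 ht.2)
    have hne : t₀ ≠ τ := by
      rintro rfl
      have : r ≤ ‖x t₀‖ := hτr
      rw [hx₀, hr] at this
      linarith [abs_nonneg B]
    have hle : ∀ t ∈ Icc t₀ τ, ‖x t‖ ≤ r := fun t ht => by
      have hcl : t ∈ closure (Ico t₀ τ) := by rwa [closure_Ico hne]
      have hcont : ContinuousOn (fun t => ‖x t‖) (closure (Ico t₀ τ)) := by
        rw [closure_Ico hne]; exact hxc.norm.mono (Icc_subset_Icc_right hτI.2)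
      exact le_on_closure hbefore hcont continuousOn_const hcl
    have h := hB τ hτI x hx₀ (hsol τ hτI hle)
    exact absurd (hτr : r ≤ ‖x τ‖) (not_le.2 (h.trans_lt hBr))
  exact ⟨x, hx₀, hsol T ⟨hT, le_rfl⟩ hlt⟩

end GlobalExistence

/-! ### Gluing solutions on growing intervals -/

section GlobalTrajectory

variable {E : Type*} [NormedAddCommGroup E] [InnerProductSpace ℝ E] [FiniteDimensional ℝ E]
  [CompleteSpace E] {g : E → ℝ → E} {t₀ : ℝ}

/-- Global existence for locally Lipschitz equations whose solutions satisfy a priori bounds. -/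
theorem exists_isTrajectory (hg : ContinuousOn (Function.uncurry g) (univ ×ˢ Ici t₀))
    (hL : ∀ r T : ℝ, ∃ K, ∀ t ∈ Icc t₀ T, LipschitzOnWith K (fun x => g x t) (Metric.ball 0 r))
    (x₀ : E)
    (hB : ∀ T, ∃ B, ∀ τ ∈ Icc t₀ T, ∀ x : ℝ → E, x t₀ = x₀ → IsSolutionOn g t₀ τ x → ‖x τ‖ ≤ B) :
    ∃ x : ℝ → E, x t₀ = x₀ ∧ IsTrajectory g t₀ x := by
  have hex : ∀ k : ℕ, ∃ x : ℝ → E, x t₀ = x₀ ∧ IsSolutionOn g t₀ (t₀ + k) x := fun k => by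
    obtain ⟨B, hB⟩ := hB (t₀ + k)
    exact exists_isSolutionOn hg (fun r => hL r _) (by simp) x₀ hB
  choose y hy₀ hy using hex
  have hcons : ∀ k l : ℕ, k ≤ l → EqOn (y k) (y l) (Icc t₀ (t₀ + k)) := fun k l hkl =>
    (hy k).eqOn ((hy l).mono (by have : (k : ℝ) ≤ l := by exact_mod_cast hkl
                                 linarith)) (fun r => hL r _) ((hy₀ k).trans (hy₀ l).symm)
  -- At each time the first available solution is used; uniqueness makes the choices agree.
  refine ⟨fun t => y ⌈t - t₀⌉₊ t, by simp [hy₀], fun t ht => ?_⟩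
  have heq : EqOn (fun s => y ⌈s - t₀⌉₊ s) (y ⌈t - t₀⌉₊) (Icc t₀ t) := fun s hs => by
    refine hcons _ _ (Nat.ceil_mono (by linarith [hs.2])) ⟨hs.1, ?_⟩
    linarith [Nat.le_ceil (s - t₀)]
  have h := (hy ⌈t - t₀⌉₊).integral_eq hg (t := t) ⟨ht, by linarith [Nat.le_ceil (t - t₀)]⟩
  have heq' : EqOn (fun s => g (y ⌈t - t₀⌉₊ s) s) (fun s => g (y ⌈s - t₀⌉₊ s) s) (uIcc t₀ t) :=
    fun s hs => by
      rw [uIcc_of_le ht] at hs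
      have := heq hs
      simp only at this ⊢
      rw [this]
  refine ⟨h.1.congr (heq'.mono uIoc_subset_uIcc), ?_⟩
  simp only
  rw [← intervalIntegral.integral_congr heq', h.2]
  simp [hy₀]

end GlobalTrajectory

section LocallyLipschitz

variable {E : Type*} [NormedAddCommGroup E] [NormedSpace ℝ E] [FiniteDimensional ℝ E]
  {f : E → ℝ → E}

theorem exists_lipschitzOnWith_ball (hf : ContDiffOn ℝ 1 (Function.uncurry f) (univ ×ˢ Ici 0))
    {t₀ : ℝ} (ht₀ : 0 ≤ t₀) (r T : ℝ) :
    ∃ K, ∀ t ∈ Icc t₀ T, LipschitzOnWith K (fun x => f x t) (Metric.ball 0 r) := by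
  have hcomp : IsCompact (Metric.closedBall (0 : E) r ×ˢ Icc t₀ T) :=
    (isCompact_closedBall _ _).prod isCompact_Icc
  obtain ⟨C, hC⟩ := hcomp.exists_bound_of_continuousOn
    ((continuousOn_fderiv_space hf).mono fun q hq => ⟨trivial, ht₀.trans hq.2.1⟩)
  refine ⟨C.toNNReal, fun t ht => (convex_ball _ _).lipschitzOnWith_of_nnnorm_fderiv_le
    (𝕜 := ℝ) (fun x _ => (hasFDerivAt_space hf (ht₀.trans ht.1)).differentiableAt) fun x hx => ?_⟩
  rw [← NNReal.coe_le_coe, coe_nnnorm]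
  exact (hC (x, t) ⟨Metric.ball_subset_closedBall hx, ht⟩).trans (Real.le_coe_toNNReal C)

end LocallyLipschitz

/-! ### Comparison functions -/

section ComparisonFunctions

theorem isClassK_const_mul {c : ℝ} (hc : 0 < c) : IsClassK fun r => c * r where
  continuousOn := by fun_prop
  strictMonoOn := fun _ _ _ _ h => mul_lt_mul_of_pos_left h hc
  map_zero := mul_zero c

theorem IsClassK.nonneg {α : ℝ → ℝ} (hα : IsClassK α) {r : ℝ} (hr : 0 ≤ r) : 0 ≤ α r := by
  rw [← hα.map_zero]
  exact hα.strictMonoOn.monotoneOn self_mem_Ici hr hr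

theorem IsClassK.isClassKL_exp_mul {α : ℝ → ℝ} (hα : IsClassK α) {lam : ℝ} (hlam : 0 < lam) :
    IsClassKL fun r s => Real.exp (-lam * s) * α r where
  classK s _ :=
    { continuousOn := continuousOn_const.mul hα.continuousOn
      strictMonoOn := fun _ ha _ hb h =>
        mul_lt_mul_of_pos_left (hα.strictMonoOn ha hb h) (Real.exp_pos _)
      map_zero := by simp [hα.map_zero] }
  antitoneOn r hr s _ t _ hst := by
    refine mul_le_mul_of_nonneg_right (Real.exp_le_exp.2 ?_) (hα.nonneg hr)
    nlinarith
  tendsto_zero r _ := by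
    have h : Tendsto (fun s : ℝ => -lam * s) atTop atBot :=
      tendsto_id.const_mul_atTop_of_neg (neg_lt_zero.2 hlam)
    simpa using (Real.tendsto_exp_atBot.comp h).mul_const (α r)

end ComparisonFunctions

/-! ### The error ball, existence of perturbed trajectories, and input-to-state stability -/

section InputToState

variable {E : Type*} [NormedAddCommGroup E] [InnerProductSpace ℝ E] [FiniteDimensional ℝ E]
  [CompleteSpace E] {f : E → ℝ → E} {Θ : E → ℝ → E →L[ℝ] E} {lam m : ℝ} {t₀ : ℝ}

theorem integral_exp_neg_mul_sub (hlam : lam ≠ 0) (t₀ t : ℝ) :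
    ∫ τ in t₀..t, Real.exp (-lam * (t - τ)) = (1 - Real.exp (-lam * (t - t₀))) / lam := by
  have hd : ∀ τ ∈ uIcc t₀ t, HasDerivAt (fun τ => Real.exp (-lam * (t - τ)) / lam)
      (Real.exp (-lam * (t - τ))) τ := fun τ _ => by
    have h := (((hasDerivAt_id τ).const_sub t).const_mul (-lam)).exp.div_const lam
    simpa [hlam] using h
  rw [intervalIntegral.integral_eq_sub_of_hasDerivAt hd
    ((by fun_prop : Continuous fun τ : ℝ => Real.exp (-lam * (t - τ))).intervalIntegrable _ _)]
  simp [sub_div]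

omit [FiniteDimensional ℝ E] [CompleteSpace E] in
theorem IsTrajectory.isPerturbedArc_add
    (hf : ContinuousOn (Function.uncurry f) (univ ×ˢ Ici 0)) {d : E → ℝ → E} (ht₀ : 0 ≤ t₀)
    {P : ℝ → E} (hP : IsTrajectory (fun x t => f x t + d x t) t₀ P) {T : ℝ} (hT : t₀ ≤ T) :
    IsPerturbedArc f (fun t => d (P t) t) t₀ T P :=
  isPerturbedArc_of_integral hf ht₀ hT fun t ht => hP t ht.1

omit [FiniteDimensional ℝ E] [CompleteSpace E] in
theorem IsTrajectory.isPerturbedArc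
    (hf : ContinuousOn (Function.uncurry f) (univ ×ˢ Ici 0)) (ht₀ : 0 ≤ t₀)
    {P : ℝ → E} (hP : IsTrajectory f t₀ P) {T : ℝ} (hT : t₀ ≤ T) :
    IsPerturbedArc f 0 t₀ T P :=
  isPerturbedArc_of_integral (d := fun _ _ => 0) hf ht₀ hT fun t ht => by simpa using hP t ht.1

namespace IsContracting

variable (hc : IsContracting f Θ lam m)
include hc

omit [FiniteDimensional ℝ E] in
theorem sqrt_mul_norm_sub_le_pathDist {t : ℝ} (ht : 0 ≤ t) (x y : E) :
    √m * ‖y - x‖ ≤ pathDist (fun z => Θ z t) x y :=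
  mul_norm_sub_le_pathDist (continuous_slice hc.contDiffOn_factor ht) (Real.sqrt_nonneg m)
    (fun x v => hc.sqrt_mul_norm_le (x := x) ht v) x y

omit [FiniteDimensional ℝ E] in
theorem norm_sub_le_pathDist_div {t : ℝ} (ht : 0 ≤ t) (x y : E) :
    ‖y - x‖ ≤ pathDist (fun z => Θ z t) x y / √m := by
  rw [le_div_iff₀ (Real.sqrt_pos.2 hc.lower_pos), mul_comm]
  exact hc.sqrt_mul_norm_sub_le_pathDist ht x y

/-- Exponential convergence to the error ball. -/
theorem pathDist_le_of_ae_norm_le (ht₀ : 0 ≤ t₀) {T : ℝ} (hT : t₀ ≤ T) {P₁ P₂ u : ℝ → E}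
    (h₁ : IsPerturbedArc f 0 t₀ T P₁) (h₂ : IsPerturbedArc f u t₀ T P₂) {D : ℝ}
    (hD : ∀ᵐ τ ∂(volume.restrict (Icc t₀ T)), ‖Θ (P₂ τ) τ (u τ)‖ ≤ D) :
    pathDist (fun z => Θ z T) (P₁ T) (P₂ T) ≤
      Real.exp (-lam * (T - t₀)) * pathDist (fun z => Θ z t₀) (P₁ t₀) (P₂ t₀) +
      D * ((1 - Real.exp (-lam * (T - t₀))) / lam) := by
  refine (hc.pathDist_le ht₀ hT h₁ h₂).trans (add_le_add_right ?_ _)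
  have hΘu := h₂.intervalIntegrable.clm_apply_continuousOn hT (continuousOn_comp_curve
    hc.contDiffOn_factor.continuousOn (Icc_subset_Ici_zero T ht₀) h₂.continuousOn)
  have hexp : Continuous fun τ : ℝ => Real.exp (-lam * (T - τ)) := by fun_prop
  rw [← integral_exp_neg_mul_sub hc.rate_pos.ne', ← intervalIntegral.integral_const_mul]
  refine intervalIntegral.integral_mono_ae_restrict hT
    (hΘu.norm.continuousOn_mul hexp.continuousOn) ((hexp.intervalIntegrable _ _).const_mul D) ?_
  filter_upwards [hD] with τ hτ
  rw [mul_comm D]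
  exact mul_le_mul_of_nonneg_left hτ (Real.exp_pos _).le

theorem pathDist_le_of_forall_norm_le (ht₀ : 0 ≤ t₀) {T : ℝ} (hT : t₀ ≤ T) {P₁ P₂ u : ℝ → E}
    (h₁ : IsPerturbedArc f 0 t₀ T P₁) (h₂ : IsPerturbedArc f u t₀ T P₂) {D : ℝ}
    (hD : ∀ τ ∈ Icc t₀ T, ‖Θ (P₂ τ) τ (u τ)‖ ≤ D) :
    pathDist (fun z => Θ z T) (P₁ T) (P₂ T) ≤
      Real.exp (-lam * (T - t₀)) * pathDist (fun z => Θ z t₀) (P₁ t₀) (P₂ t₀) + 1 / lam * D := by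
  refine (hc.pathDist_le_of_ae_norm_le ht₀ hT h₁ h₂ (D := D) ?_).trans (add_le_add_right ?_ _)
  · filter_upwards [ae_restrict_mem measurableSet_Icc] with τ hτ using hD τ hτ
  · have hD0 : 0 ≤ D := (norm_nonneg _).trans (hD T ⟨hT, le_rfl⟩)
    rw [mul_comm]
    refine mul_le_mul_of_nonneg_right ?_ hD0
    have := hc.rate_pos
    gcongr
    linarith [Real.exp_pos (-lam * (T - t₀))]

/-- Trajectories of the perturbed system exist for all times if the weighted perturbation is
bounded. -/
theorem exists_isTrajectory_add (ht₀ : 0 ≤ t₀) {P₁ : ℝ → E} (hP₁ : IsTrajectory f t₀ P₁)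
    {d : E → ℝ → E} (hd : ContinuousOn (Function.uncurry d) (univ ×ˢ Ici t₀))
    (hL : ∀ r T : ℝ, ∃ K, ∀ t ∈ Icc t₀ T, LipschitzOnWith K (fun x => d x t) (Metric.ball 0 r))
    {D : ℝ} (hD : ∀ x t, t₀ ≤ t → ‖Θ x t (d x t)‖ ≤ D) (x₀ : E) :
    ∃ P₂ : ℝ → E, P₂ t₀ = x₀ ∧ IsTrajectory (fun x t => f x t + d x t) t₀ P₂ := by
  have hfc := hc.contDiffOn_field.continuousOn
  have hsub : (univ : Set E) ×ˢ Ici t₀ ⊆ univ ×ˢ Ici 0 :=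
    prod_mono_right (Ici_subset_Ici.2 ht₀)
  have hg : ContinuousOn (Function.uncurry fun x t => f x t + d x t) (univ ×ˢ Ici t₀) :=
    (hfc.mono hsub).add hd
  refine exists_isTrajectory hg (fun r T => ?_) x₀ fun T => ?_
  · obtain ⟨K₁, hK₁⟩ := exists_lipschitzOnWith_ball hc.contDiffOn_field ht₀ r T
    obtain ⟨K₂, hK₂⟩ := hL r T
    exact ⟨K₁ + K₂, fun t ht => (hK₁ t ht).add (hK₂ t ht)⟩
  · rcases lt_or_ge T t₀ with hT | hT
    · exact ⟨0, fun τ hτ => absurd (hτ.1.trans hτ.2) (not_le.2 hT)⟩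
    obtain ⟨r, hr⟩ := isCompact_Icc.exists_bound_of_continuousOn
      (hP₁.isPerturbedArc hfc ht₀ hT).continuousOn
    set R₀ := pathDist (fun z => Θ z t₀) (P₁ t₀) x₀ with hR₀
    -- The a priori bound: `P₁` stays within `r`, and contraction keeps the solution within weighted
    -- distance `R₀ + D / lam` of it, for as long as it exists.
    refine ⟨r + (R₀ + 1 / lam * D) / √m, fun τ hτ x hx₀ hx => ?_⟩
    have h₂ : IsPerturbedArc f (fun t => d (x t) t) t₀ τ x :=
      isPerturbedArc_of_integral hfc ht₀ hτ.1 fun t ht => hx.integral_eq hg ht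
    have h := hc.pathDist_le_of_forall_norm_le ht₀ hτ.1 (hP₁.isPerturbedArc hfc ht₀ hτ.1) h₂
      (D := D) fun s hs => hD _ _ hs.1
    rw [hx₀, ← hR₀] at h
    have he : Real.exp (-lam * (τ - t₀)) * R₀ ≤ R₀ := by
      refine mul_le_of_le_one_left (pathDist_nonneg _ _ _) (Real.exp_le_one_iff.2 ?_)
      nlinarith [hc.rate_pos, hτ.1]
    calc ‖x τ‖ = ‖P₁ τ + (x τ - P₁ τ)‖ := by rw [add_sub_cancel]
      _ ≤ ‖P₁ τ‖ + ‖x τ - P₁ τ‖ := norm_add_le _ _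
      _ ≤ r + (R₀ + 1 / lam * D) / √m := by
          refine add_le_add (hr τ hτ) ((hc.norm_sub_le_pathDist_div (ht₀.trans hτ.1) _ _).trans ?_)
          gcongr
          linarith

/-- Input-to-state stability in the distance of the metric. -/
theorem isISSAbout_pathDist (ht₀ : 0 ≤ t₀) {P₁ : ℝ → E} (hP₁ : IsTrajectory f t₀ P₁) :
    IsISSAbout f Θ (fun t => pathDist fun x => Θ x t) (fun r s => Real.exp (-lam * s) * (1 * r))
      (fun D => 1 / lam * D) t₀ P₁ := by
  have hfc := hc.contDiffOn_field.continuousOn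
  refine fun d => ⟨fun hd hL ⟨D, hD⟩ x₀ => hc.exists_isTrajectory_add ht₀ hP₁ hd hL hD x₀,
    fun P₂ hP₂ t D ht hD => ?_⟩
  simp only [one_mul]
  exact hc.pathDist_le_of_forall_norm_le ht₀ ht (hP₁.isPerturbedArc hfc ht₀ ht)
    (hP₂.isPerturbedArc_add hfc ht₀ ht) hD

/-- Input-to-state stability in the Euclidean distance, in terms of a bound for the initial
smallest path integral and of a bound for the weighted disturbance. -/
theorem isISSAbout_norm (ht₀ : 0 ≤ t₀) {P₁ : ℝ → E} (hP₁ : IsTrajectory f t₀ P₁) {α : ℝ → ℝ}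
    (hα : ∀ x, pathDist (fun z => Θ z t₀) (P₁ t₀) x ≤ √m * α ‖x - P₁ t₀‖)
    {W : E → ℝ → E →L[ℝ] E} {κ : ℝ} (hκ : 0 ≤ κ)
    (hW : ∀ x t, 0 ≤ t → ∀ v, ‖Θ x t v‖ ≤ κ * ‖W x t v‖) :
    IsISSAbout f W (fun _ x y => ‖y - x‖) (fun r s => Real.exp (-lam * s) * α r)
      (fun D => κ / (lam * √m) * D) t₀ P₁ := by
  have hfc := hc.contDiffOn_field.continuousOn
  have hm := Real.sqrt_pos.2 hc.lower_pos
  have hWD : ∀ {D : ℝ} {x : E} {t : ℝ} {v : E}, 0 ≤ t → ‖W x t v‖ ≤ D → ‖Θ x t v‖ ≤ κ * D :=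
    fun ht h => (hW _ _ ht _).trans (mul_le_mul_of_nonneg_left h hκ)
  refine fun d => ⟨fun hd hL ⟨D, hD⟩ x₀ => hc.exists_isTrajectory_add ht₀ hP₁ hd hL
    (D := κ * D) (fun x t ht => hWD (ht₀.trans ht) (hD x t ht)) x₀, fun P₂ hP₂ t D ht hD => ?_⟩
  have h := hc.pathDist_le_of_forall_norm_le ht₀ ht (hP₁.isPerturbedArc hfc ht₀ ht)
    (hP₂.isPerturbedArc_add hfc ht₀ ht) (D := κ * D) fun τ hτ => hWD (ht₀.trans hτ.1) (hD τ hτ)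
  refine (hc.norm_sub_le_pathDist_div (ht₀.trans ht) _ _).trans ?_
  rw [div_le_iff₀ hm]
  have h' := mul_le_mul_of_nonneg_left (hα (P₂ t₀)) (Real.exp_pos (-lam * (t - t₀))).le
  have hl := hc.rate_pos.ne'
  calc _ ≤ _ := h
    _ ≤ Real.exp (-lam * (t - t₀)) * (√m * α ‖P₂ t₀ - P₁ t₀‖) + 1 / lam * (κ * D) := by gcongr
    _ = _ := by field_simp

omit hc [CompleteSpace E] in
/-- The smallest path integral from a given point is bounded by a comparison function of the
Euclidean distance. -/
theorem _root_.exists_isClassK_pathDist_le {W : E → E →L[ℝ] E} (hW : Continuous W) (x : E) :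
    ∃ α, IsClassK α ∧ ∀ y, pathDist W x y ≤ α ‖y - x‖ := by
  -- This is the supremum of `‖W‖` on the ball of radius `r` about `x`, parametrised by the fixed
  -- unit ball so that continuity in `r` follows from compactness.
  set c : ℝ → ℝ := fun r => sSup ((fun v => ‖W (x + r • v)‖) '' Metric.closedBall (0 : E) 1)
    with hcdef
  have hK := isCompact_closedBall (0 : E) 1
  have hcont : Continuous c := by
    refine hK.continuous_sSup (f := fun r v => ‖W (x + r • v)‖) ?_
    exact (hW.comp (by fun_prop : Continuous fun q : ℝ × E => x + q.1 • q.2)).norm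
  have hbdd : ∀ r : ℝ, BddAbove ((fun v => ‖W (x + r • v)‖) '' Metric.closedBall (0 : E) 1) :=
    fun r => hK.bddAbove_image
      (hW.comp (by fun_prop : Continuous fun v : E => x + r • v)).norm.continuousOn
  have hle : ∀ {r : ℝ}, 0 ≤ r → ∀ w : E, ‖w‖ ≤ r → ‖W (x + w)‖ ≤ c r := fun {r} hr w hw => by
    refine le_csSup (hbdd r) ⟨r⁻¹ • w, ?_, ?_⟩
    · rw [mem_closedBall_zero_iff, norm_smul, norm_inv, Real.norm_of_nonneg hr, inv_mul_eq_div]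
      exact div_le_one_of_le₀ hw hr
    · rcases hr.eq_or_lt with rfl | hr'
      · simp [norm_le_zero_iff.1 hw]
      · simp [smul_smul, hr'.ne']
  have hc0 : ∀ r, 0 ≤ r → 0 ≤ c r := fun r hr => (norm_nonneg _).trans (hle hr 0 (by simpa))
  have hmono : ∀ a b, 0 ≤ a → a ≤ b → c a ≤ c b := fun a b ha hab => by
    refine csSup_le (Set.Nonempty.image _ ⟨0, by simp⟩) ?_
    rintro _ ⟨v, hv, rfl⟩
    refine hle (ha.trans hab) _ ?_
    rw [norm_smul, Real.norm_of_nonneg ha]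
    rw [mem_closedBall_zero_iff] at hv
    nlinarith [norm_nonneg v]
  -- The summand 1 makes the function strictly increasing even where `c` vanishes.
  refine ⟨fun r => (c r + 1) * r, ⟨by fun_prop, fun a ha b hb hab => ?_, by simp⟩, fun y => ?_⟩
  · have ha' : 0 ≤ a := ha
    have h1 := hmono a b ha' hab.le
    have h2 := hc0 a ha'
    nlinarith
  · refine pathDist_le_of_segment _ _ _ fun s hs => ?_
    refine (ContinuousLinearMap.le_of_opNorm_le _ (hle (norm_nonneg (y - x)) _ ?_) _).trans ?_
    · rw [norm_smul, Real.norm_of_nonneg hs.1]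
      exact mul_le_of_le_one_left (norm_nonneg _) hs.2
    · exact mul_le_mul_of_nonneg_right (lt_add_one _).le (norm_nonneg _)

omit hc [FiniteDimensional ℝ E] in
theorem _root_.norm_le_sqrt_mul_of_metricTensor_le {Mbar : ℝ}
    (hM : ∀ x t, 0 ≤ t → ∀ v, inner ℝ v (metricTensor Θ x t v) ≤ Mbar * ‖v‖ ^ 2) (x : E) (t : ℝ)
    (ht : 0 ≤ t) (v : E) : ‖Θ x t v‖ ≤ √Mbar * ‖v‖ := by
  have h := hM x t ht v
  rw [metricTensor, ContinuousLinearMap.comp_apply, ContinuousLinearMap.adjoint_inner_right,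
    real_inner_self_eq_norm_sq] at h
  have h' := Real.sqrt_le_sqrt h
  rwa [Real.sqrt_sq (norm_nonneg _), Real.sqrt_mul' _ (sq_nonneg _),
    Real.sqrt_sq (norm_nonneg _)] at h'

end IsContracting

end InputToState

/-! ### `L^p` bounds for convolution with the causal exponential kernel -/

section Convolution

/-- Schur's test for a kernel whose rows and columns have the same bound. -/
theorem lintegral_rpow_kernel_le {α : Type*} [MeasurableSpace α] {μ : Measure α} [SFinite μ]
    {k : α → α → ℝ≥0∞} (hk : Measurable (Function.uncurry k)) {c : ℝ≥0∞}
    (hrow : ∀ t, ∫⁻ τ, k t τ ∂μ ≤ c) (hcol : ∀ τ, ∫⁻ t, k t τ ∂μ ≤ c) {g : α → ℝ≥0∞}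
    (hg : AEMeasurable g μ) {p : ℝ} (hp : 1 ≤ p) :
    ∫⁻ t, (∫⁻ τ, k t τ * g τ ∂μ) ^ p ∂μ ≤ c ^ p * ∫⁻ τ, g τ ^ p ∂μ := by
  have hp0 : 0 < p := zero_lt_one.trans_le hp
  have hkt : ∀ t, Measurable (k t) := fun t => hk.of_uncurry_left
  -- Hölder's inequality for the measure with density `k t`, whose total mass is at most `c` by the
  -- row bound; the column bound enters after exchanging the integrals.
  have hinner : ∀ t, (∫⁻ τ, k t τ * g τ ∂μ) ^ p ≤ (∫⁻ τ, k t τ * g τ ^ p ∂μ) * c ^ (p - 1) :=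
    fun t => by
      have hac := withDensity_absolutelyContinuous μ (k t)
      have h := eLpNorm'_le_eLpNorm'_mul_rpow_measure_univ (μ := μ.withDensity (k t)) (f := g)
        zero_lt_one hp (hg.mono_ac hac).aestronglyMeasurable
      simp only [eLpNorm'_eq_lintegral_enorm, enorm_eq_self, ENNReal.rpow_one, div_one] at h
      rw [lintegral_withDensity_eq_lintegral_mul₀ (hkt t).aemeasurable hg,
        lintegral_withDensity_eq_lintegral_mul₀ (hkt t).aemeasurable (hg.pow_const p),
        withDensity_apply _ MeasurableSet.univ, setLIntegral_univ] at h
      calc (∫⁻ τ, k t τ * g τ ∂μ) ^ p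
          ≤ ((∫⁻ τ, k t τ * g τ ^ p ∂μ) ^ (1 / p) * c ^ (1 - 1 / p)) ^ p := by
            refine ENNReal.rpow_le_rpow (h.trans ?_) hp0.le
            refine mul_le_mul_right (ENNReal.rpow_le_rpow (hrow t) ?_) _
            rw [sub_nonneg, div_le_one hp0]; exact hp
        _ = (∫⁻ τ, k t τ * g τ ^ p ∂μ) * c ^ (p - 1) := by
            rw [ENNReal.mul_rpow_of_nonneg _ _ hp0.le, ← ENNReal.rpow_mul, ← ENNReal.rpow_mul,
              one_div_mul_cancel hp0.ne', ENNReal.rpow_one]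
            congr 2; field_simp
  have hmeas : AEMeasurable (Function.uncurry fun t τ => k t τ * g τ ^ p) (μ.prod μ) :=
    hk.aemeasurable.mul (hg.pow_const p).comp_snd
  calc ∫⁻ t, (∫⁻ τ, k t τ * g τ ∂μ) ^ p ∂μ
      ≤ ∫⁻ t, (∫⁻ τ, k t τ * g τ ^ p ∂μ) * c ^ (p - 1) ∂μ := lintegral_mono hinner
    _ = (∫⁻ t, ∫⁻ τ, k t τ * g τ ^ p ∂μ ∂μ) * c ^ (p - 1) :=
        lintegral_mul_const'' _ hmeas.lintegral_prod_right'
    _ = (∫⁻ τ, ∫⁻ t, k t τ * g τ ^ p ∂μ ∂μ) * c ^ (p - 1) := by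
        rw [lintegral_lintegral_swap hmeas]
    _ ≤ (∫⁻ τ, c * g τ ^ p ∂μ) * c ^ (p - 1) := by
        refine mul_le_mul_left (lintegral_mono fun τ => ?_) _
        rw [lintegral_mul_const _ hk.of_uncurry_right]
        exact mul_le_mul_left (hcol τ) _
    _ = c ^ p * ∫⁻ τ, g τ ^ p ∂μ := by
        rw [lintegral_const_mul'' _ (hg.pow_const p), mul_right_comm]
        congr 1
        conv_lhs => rw [← ENNReal.rpow_one c]
        rw [← ENNReal.rpow_mul, one_mul,
          ← ENNReal.rpow_add_of_nonneg _ _ zero_le_one (sub_nonneg.2 hp), add_sub_cancel]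

/-- The causal exponential kernel. -/
noncomputable def expKernel (lam s : ℝ) : ℝ≥0∞ :=
  (Ici (0 : ℝ)).indicator (fun s => ENNReal.ofReal (Real.exp (-lam * s))) s

theorem measurable_expKernel (lam : ℝ) : Measurable (expKernel lam) :=
  Measurable.indicator (by fun_prop) measurableSet_Ici

theorem lintegral_expKernel {lam : ℝ} (hlam : 0 < lam) :
    ∫⁻ s, expKernel lam s = ENNReal.ofReal (1 / lam) := by
  have hneg : -lam < 0 := neg_lt_zero.2 hlam
  rw [show expKernel lam = (Ici (0 : ℝ)).indicator
      (fun s => ENNReal.ofReal (Real.exp (-lam * s))) from rfl,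
    lintegral_indicator measurableSet_Ici, setLIntegral_congr Ioi_ae_eq_Ici.symm,
    ← ofReal_integral_eq_lintegral_ofReal (integrableOn_exp_mul_Ioi hneg 0)
      (Eventually.of_forall fun _ => (Real.exp_pos _).le), integral_exp_mul_Ioi hneg]
  simp [neg_div_neg_eq]

/-- The kernel, truncated to `[0, T]` in either variable, has mass at most `1 / lam`. Schur's test
then covers finite `p`, and the row bound alone covers `p = ∞`. -/
theorem eLpNorm_expConvolution_le {lam : ℝ} (hlam : 0 < lam) {p : ℝ≥0∞} (hp : 1 ≤ p) {T : ℝ}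
    {g : ℝ → ℝ} (hg : AEStronglyMeasurable g (volume.restrict (Icc 0 T))) :
    eLpNorm (fun t => ∫ τ in (0 : ℝ)..t, Real.exp (-lam * (t - τ)) * g τ) p
      (volume.restrict (Icc 0 T)) ≤
      ENNReal.ofReal (1 / lam) * eLpNorm g p (volume.restrict (Icc 0 T)) := by
  set μ := volume.restrict (Icc (0 : ℝ) T) with hμ
  set k : ℝ → ℝ → ℝ≥0∞ := fun t τ => expKernel lam (t - τ) with hk
  have hkm : Measurable (Function.uncurry k) :=
    (measurable_expKernel lam).comp (measurable_fst.sub measurable_snd)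
  have hrow : ∀ t, ∫⁻ τ, k t τ ∂μ ≤ ENNReal.ofReal (1 / lam) := fun t => by
    refine (lintegral_mono' Measure.restrict_le_self le_rfl).trans (le_of_eq ?_)
    rw [← lintegral_expKernel hlam]
    exact lintegral_sub_left_eq_self (expKernel lam) t
  have hcol : ∀ τ, ∫⁻ t, k t τ ∂μ ≤ ENNReal.ofReal (1 / lam) := fun τ => by
    refine (lintegral_mono' Measure.restrict_le_self le_rfl).trans (le_of_eq ?_)
    rw [← lintegral_expKernel hlam]
    exact lintegral_sub_right_eq_self (expKernel lam) τ
  have hpt : ∀ t ∈ Icc 0 T, ‖∫ τ in (0 : ℝ)..t, Real.exp (-lam * (t - τ)) * g τ‖ₑ ≤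
      ∫⁻ τ, k t τ * ‖g τ‖ₑ ∂μ := fun t ht => by
    rw [intervalIntegral.integral_of_le ht.1]
    refine (enorm_integral_le_lintegral_enorm _).trans ?_
    calc ∫⁻ τ in Ioc 0 t, ‖Real.exp (-lam * (t - τ)) * g τ‖ₑ
        = ∫⁻ τ in Ioc 0 t, k t τ * ‖g τ‖ₑ := by
          refine setLIntegral_congr_fun measurableSet_Ioc fun τ hτ => ?_
          have hmem : t - τ ∈ Ici (0 : ℝ) := sub_nonneg.2 hτ.2
          simp only [hk, expKernel, indicator_of_mem hmem, enorm_mul]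
          rw [Real.enorm_of_nonneg (Real.exp_pos _).le]
      _ ≤ ∫⁻ τ, k t τ * ‖g τ‖ₑ ∂μ :=
          lintegral_mono_set fun τ hτ => ⟨hτ.1.le, hτ.2.trans ht.2⟩
  rcases eq_or_ne p ∞ with rfl | hpt'
  · rw [eLpNorm_exponent_top, eLpNorm_exponent_top]
    refine eLpNormEssSup_le_of_ae_enorm_bound ?_
    filter_upwards [ae_restrict_mem measurableSet_Icc] with t ht
    refine (hpt t ht).trans ?_
    calc ∫⁻ τ, k t τ * ‖g τ‖ₑ ∂μ ≤ ∫⁻ τ, k t τ * eLpNormEssSup g μ ∂μ := by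
          refine lintegral_mono_ae ?_
          filter_upwards [enorm_ae_le_eLpNormEssSup g μ] with τ hτ
          gcongr
      _ = (∫⁻ τ, k t τ ∂μ) * eLpNormEssSup g μ := lintegral_mul_const _ hkm.of_uncurry_left
      _ ≤ _ := mul_le_mul_left (hrow t) _
  · have hp0 : p ≠ 0 := (zero_lt_one.trans_le hp).ne'
    have hp1 : 1 ≤ p.toReal := by
      rwa [← ENNReal.toReal_one, ENNReal.toReal_le_toReal ENNReal.one_ne_top hpt']
    have hp1' : 0 < p.toReal := zero_lt_one.trans_le hp1
    rw [eLpNorm_eq_lintegral_rpow_enorm_toReal hp0 hpt',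
      eLpNorm_eq_lintegral_rpow_enorm_toReal hp0 hpt']
    have h : ∫⁻ t, ‖∫ τ in (0 : ℝ)..t, Real.exp (-lam * (t - τ)) * g τ‖ₑ ^ p.toReal ∂μ ≤
        ENNReal.ofReal (1 / lam) ^ p.toReal * ∫⁻ τ, ‖g τ‖ₑ ^ p.toReal ∂μ := by
      refine le_trans (lintegral_mono_ae ?_)
        (lintegral_rpow_kernel_le hkm hrow hcol hg.enorm hp1)
      filter_upwards [ae_restrict_mem measurableSet_Icc] with t ht
      exact ENNReal.rpow_le_rpow (hpt t ht) hp1'.le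
    refine (ENNReal.rpow_le_rpow h (by positivity)).trans (le_of_eq ?_)
    rw [ENNReal.mul_rpow_of_nonneg _ _ (by positivity), ← ENNReal.rpow_mul,
      mul_one_div_cancel hp1'.ne', ENNReal.rpow_one]

/-- Factoring the kernel as `exp (-lam t) exp (lam τ)` leaves a continuous primitive. -/
theorem aestronglyMeasurable_expConvolution (lam : ℝ) {T : ℝ} (hT : 0 ≤ T) {g : ℝ → ℝ}
    (hg : IntegrableOn g (Icc 0 T)) :
    AEStronglyMeasurable (fun t => ∫ τ in (0 : ℝ)..t, Real.exp (-lam * (t - τ)) * g τ)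
      (volume.restrict (Icc 0 T)) := by
  have hgi : IntegrableOn (fun s => Real.exp (lam * s) * g s) (uIcc 0 T) := by
    rw [uIcc_of_le hT]
    exact hg.continuousOn_mul (by fun_prop) isCompact_Icc
  have hprim : ContinuousOn (fun t => Real.exp (-lam * t) *
      ∫ s in (0 : ℝ)..t, Real.exp (lam * s) * g s) (uIcc 0 T) :=
    ContinuousOn.mul (by fun_prop) (intervalIntegral.continuousOn_primitive_interval hgi)
  rw [uIcc_of_le hT] at hprim
  refine (hprim.aestronglyMeasurable measurableSet_Icc).congr (Eventually.of_forall fun t => ?_)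
  simp only
  rw [← intervalIntegral.integral_const_mul]
  refine intervalIntegral.integral_congr fun s _ => ?_
  rw [← mul_assoc, ← Real.exp_add]
  congr 2; ring

theorem eLpNorm_exp_le_zetaConst {lam : ℝ} (hlam : 0 < lam) {p : ℝ≥0∞} (hp : 1 ≤ p) (T : ℝ) :
    eLpNorm (fun t => Real.exp (-lam * t)) p (volume.restrict (Icc 0 T)) ≤
      ENNReal.ofReal (zetaConst lam p) := by
  rcases eq_or_ne p ∞ with rfl | hpt
  · rw [zetaConst, if_pos rfl, eLpNorm_exponent_top]
    refine eLpNormEssSup_le_of_ae_bound ?_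
    filter_upwards [ae_restrict_mem measurableSet_Icc] with t ht
    rw [Real.norm_of_nonneg (Real.exp_pos _).le, Real.exp_le_one_iff]
    nlinarith [ht.1]
  · have hp0 : p ≠ 0 := (zero_lt_one.trans_le hp).ne'
    have hp' : 0 < p.toReal := ENNReal.toReal_pos hp0 hpt
    rw [zetaConst, if_neg hpt, eLpNorm_eq_lintegral_rpow_enorm_toReal hp0 hpt]
    have h : ∫⁻ t in Icc 0 T, ‖Real.exp (-lam * t)‖ₑ ^ p.toReal ≤
        ENNReal.ofReal (1 / (lam * p.toReal)) := by
      rw [← lintegral_expKernel (mul_pos hlam hp')]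
      refine le_trans (le_of_eq ?_) (setLIntegral_le_lintegral (Icc 0 T) _)
      refine setLIntegral_congr_fun measurableSet_Icc fun t ht => ?_
      have hmem : t ∈ Ici (0 : ℝ) := ht.1
      simp only [expKernel, indicator_of_mem hmem]
      rw [Real.enorm_of_nonneg (Real.exp_pos _).le, ENNReal.ofReal_rpow_of_pos (Real.exp_pos _),
        ← Real.exp_mul]
      congr 2; ring
    refine (ENNReal.rpow_le_rpow h (by positivity)).trans (le_of_eq ?_)
    rw [ENNReal.ofReal_rpow_of_pos (by positivity), Real.div_rpow zero_le_one (by positivity),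
      Real.one_rpow]

end Convolution

/-! ### Upper limits -/

section Limsup

/-- Nonnegativity supplies the coboundedness that a real-valued `limsup` requires. -/
theorem limsup_le_of_eventually_le_of_tendsto {R B : ℝ → ℝ} {b : ℝ} (hR : ∀ t, 0 ≤ R t)
    (hRB : ∀ᶠ t in atTop, R t ≤ B t) (hB : Tendsto B atTop (𝓝 b)) : limsup R atTop ≤ b := by
  refine le_of_forall_gt_imp_ge_of_dense fun c hc => ?_
  refine limsup_le_of_le (isCoboundedUnder_le_of_le atTop (x := 0) hR) ?_
  filter_upwards [hRB, hB.eventually (gt_mem_nhds hc)] with t h₁ h₂ using h₁.trans h₂.le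

end Limsup

/-! ### Gains from the disturbance to the output -/

section OutputStability

variable {E : Type*} [NormedAddCommGroup E] [InnerProductSpace ℝ E] [FiniteDimensional ℝ E]
  [CompleteSpace E] {f : E → ℝ → E} {Θ : E → ℝ → E →L[ℝ] E} {lam m : ℝ} {P₁ P₂ u : ℝ → E}
  {η₁ η₂ : ℝ} {Δy : ℝ → ℝ}

namespace IsContracting

variable (hc : IsContracting f Θ lam m)
include hc

omit [FiniteDimensional ℝ E] in
/-- The output deviation in terms of the smallest path integral and of the weighted
perturbation. -/
theorem output_le (hη₁ : 0 ≤ η₁) (hη₂ : 0 ≤ η₂)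
    (hΔ : ∀ t, 0 ≤ t → Δy t ≤ η₁ * euclidPathDist (P₁ t) (P₂ t) + η₂ * ‖u t‖) {t : ℝ}
    (ht : 0 ≤ t) :
    Δy t ≤ η₁ / √m * pathDist (fun z => Θ z t) (P₁ t) (P₂ t) +
      η₂ / √m * ‖Θ (P₂ t) t (u t)‖ := by
  have hm := Real.sqrt_pos.2 hc.lower_pos
  have h₁ := (euclidPathDist_le (P₁ t) (P₂ t)).trans (hc.norm_sub_le_pathDist_div ht _ _)
  have h₂ : ‖u t‖ ≤ ‖Θ (P₂ t) t (u t)‖ / √m := by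
    rw [le_div_iff₀ hm, mul_comm]
    exact hc.sqrt_mul_norm_le ht _
  refine (hΔ t ht).trans ?_
  rw [div_mul_eq_mul_div, div_mul_eq_mul_div, mul_div_assoc, mul_div_assoc]
  gcongr

/-- Finite-gain `ℒ_p` stability. -/
theorem eLpNorm_output_le (hη₁ : 0 ≤ η₁) (hη₂ : 0 ≤ η₂) (hΔ₀ : ∀ t, 0 ≤ Δy t)
    (hΔ : ∀ t, 0 ≤ t → Δy t ≤ η₁ * euclidPathDist (P₁ t) (P₂ t) + η₂ * ‖u t‖) {τ : ℝ}
    (hτ : 0 ≤ τ) (h₁ : ∀ t ∈ Icc 0 τ, IsPerturbedArc f 0 0 t P₁)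
    (h₂ : ∀ t ∈ Icc 0 τ, IsPerturbedArc f u 0 t P₂) {p : ℝ≥0∞} (hp : 1 ≤ p)
    (hΘu : MemLp (fun t => Θ (P₂ t) t (u t)) p (volume.restrict (Icc 0 τ))) :
    eLpNorm Δy p (volume.restrict (Icc 0 τ)) ≤
      ENNReal.ofReal (η₁ * zetaConst lam p * pathDist (fun z => Θ z 0) (P₁ 0) (P₂ 0) / √m) +
      ENNReal.ofReal ((η₁ / lam + η₂) / √m) *
        eLpNorm (fun t => Θ (P₂ t) t (u t)) p (volume.restrict (Icc 0 τ)) := by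
  have hm := Real.sqrt_pos.2 hc.lower_pos
  have hl := hc.rate_pos
  set μ := volume.restrict (Icc (0 : ℝ) τ) with hμ
  set R₀ := pathDist (fun z => Θ z 0) (P₁ 0) (P₂ 0) with hR₀
  have hR₀' : 0 ≤ R₀ := pathDist_nonneg _ _ _
  set g : ℝ → ℝ := fun t => ‖Θ (P₂ t) t (u t)‖ with hg
  have hgm : MemLp g p μ := hΘu.norm
  set N := eLpNorm (fun t => Θ (P₂ t) t (u t)) p μ with hN
  have hgN : eLpNorm g p μ = N := eLpNorm_norm _
  set A : ℝ → ℝ := fun t => Real.exp (-lam * t) with hA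
  set B : ℝ → ℝ := fun t => ∫ s in (0 : ℝ)..t, Real.exp (-lam * (t - s)) * g s with hB
  have hBm : AEStronglyMeasurable B μ :=
    aestronglyMeasurable_expConvolution lam hτ (hgm.integrable hp)
  have hAm : AEStronglyMeasurable A μ :=
    (by fun_prop : Continuous A).aestronglyMeasurable
  have hle : ∀ᵐ t ∂μ, ‖Δy t‖ ≤
      (((η₁ / √m * R₀) • A + (η₁ / √m) • B) + (η₂ / √m) • g) t := by
    filter_upwards [ae_restrict_mem measurableSet_Icc] with t ht
    rw [Real.norm_of_nonneg (hΔ₀ t)]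
    refine (hc.output_le hη₁ hη₂ hΔ ht.1).trans ?_
    have h := hc.pathDist_le le_rfl ht.1 (h₁ t ht) (h₂ t ht)
    rw [sub_zero] at h
    have h' := mul_le_mul_of_nonneg_left h (show 0 ≤ η₁ / √m by positivity)
    simp only [Pi.add_apply, Pi.smul_apply, smul_eq_mul, hA, hB, hg]
    linarith
  calc eLpNorm Δy p μ
      ≤ eLpNorm (((η₁ / √m * R₀) • A + (η₁ / √m) • B) + (η₂ / √m) • g) p μ :=
        eLpNorm_mono_ae_real hle
    _ ≤ eLpNorm ((η₁ / √m * R₀) • A) p μ + eLpNorm ((η₁ / √m) • B) p μ +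
          eLpNorm ((η₂ / √m) • g) p μ :=
        (eLpNorm_add_le ((hAm.const_smul _).add (hBm.const_smul _))
          (hgm.aestronglyMeasurable.const_smul _) hp).trans
          (add_le_add_left (eLpNorm_add_le (hAm.const_smul _) (hBm.const_smul _) hp) _)
    _ ≤ ENNReal.ofReal (η₁ / √m * R₀) * ENNReal.ofReal (zetaConst lam p) +
          ENNReal.ofReal (η₁ / √m) * (ENNReal.ofReal (1 / lam) * N) +
          ENNReal.ofReal (η₂ / √m) * N := by
        rw [eLpNorm_const_smul, eLpNorm_const_smul, eLpNorm_const_smul, hgN,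
          Real.enorm_of_nonneg (by positivity), Real.enorm_of_nonneg (by positivity),
          Real.enorm_of_nonneg (by positivity)]
        gcongr
        · exact eLpNorm_exp_le_zetaConst hl hp τ
        · rw [← hgN]
          exact eLpNorm_expConvolution_le hl hp hgm.aestronglyMeasurable
    _ = _ := by
        have e₁ : ENNReal.ofReal (η₁ / √m * R₀) * ENNReal.ofReal (zetaConst lam p) =
            ENNReal.ofReal (η₁ * zetaConst lam p * R₀ / √m) := by
          rw [← ENNReal.ofReal_mul (by positivity)]
          congr 1; ring
        have e₂ : ENNReal.ofReal ((η₁ / lam + η₂) / √m) =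
            ENNReal.ofReal (η₁ / √m) * ENNReal.ofReal (1 / lam) + ENNReal.ofReal (η₂ / √m) := by
          rw [← ENNReal.ofReal_mul (by positivity),
            ← ENNReal.ofReal_add (by positivity) (by positivity)]
          congr 1; ring
        rw [e₁, e₂]
        ring

/-- The `ℒ_∞` gain with pointwise suprema. -/
theorem iSup_output_le (hη₁ : 0 ≤ η₁) (hη₂ : 0 ≤ η₂) (hΔ₀ : ∀ t, 0 ≤ Δy t)
    (hΔ : ∀ t, 0 ≤ t → Δy t ≤ η₁ * euclidPathDist (P₁ t) (P₂ t) + η₂ * ‖u t‖) {τ : ℝ}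
    (h₁ : ∀ t ∈ Icc 0 τ, IsPerturbedArc f 0 0 t P₁)
    (h₂ : ∀ t ∈ Icc 0 τ, IsPerturbedArc f u 0 t P₂) :
    (⨆ t ∈ Icc 0 τ, ‖Δy t‖ₑ) ≤
      ENNReal.ofReal (η₁ * pathDist (fun z => Θ z 0) (P₁ 0) (P₂ 0) / √m) +
      ENNReal.ofReal ((η₁ / lam + η₂) / √m) * ⨆ t ∈ Icc 0 τ, ‖Θ (P₂ t) t (u t)‖ₑ := by
  have hm := Real.sqrt_pos.2 hc.lower_pos
  have hl := hc.rate_pos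
  set R₀ := pathDist (fun z => Θ z 0) (P₁ 0) (P₂ 0) with hR₀
  have hR₀' : 0 ≤ R₀ := pathDist_nonneg _ _ _
  set S := ⨆ t ∈ Icc 0 τ, ‖Θ (P₂ t) t (u t)‖ₑ with hS
  refine iSup₂_le fun t ht => ?_
  rw [Real.enorm_of_nonneg (hΔ₀ t)]
  have hout := hc.output_le hη₁ hη₂ hΔ ht.1
  -- Since `0 * ∞ = 0` in `ℝ≥0∞`, an infinite supremum settles the claim only for a positive gain. A
  -- zero gain forces `η₁ = η₂ = 0`, and then the output deviation vanishes.
  rcases eq_or_ne S ∞ with hST | hST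
  · rcases (show 0 ≤ (η₁ / lam + η₂) / √m by positivity).eq_or_lt with h0 | hpos
    · have hsum : η₁ / lam + η₂ = 0 := by
        rcases div_eq_zero_iff.1 h0.symm with h | h
        · exact h
        · exact absurd h hm.ne'
      have hd : 0 ≤ η₁ / lam := by positivity
      have e₂ : η₂ = 0 := by linarith
      have e₁ : η₁ = 0 := by
        rcases div_eq_zero_iff.1 (show η₁ / lam = 0 by linarith) with h | h
        · exact h
        · exact absurd h hl.ne'
      rw [e₁, e₂] at hout
      rw [ENNReal.ofReal_of_nonpos (by simpa using hout)]
      exact zero_le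
    · rw [hST, ENNReal.mul_top (by simpa using hpos), add_top]
      exact le_top
  · have hD : ∀ s ∈ Icc 0 τ, ‖Θ (P₂ s) s (u s)‖ ≤ S.toReal := fun s hs => by
      rw [← toReal_enorm]
      exact ENNReal.toReal_mono hST (le_iSup₂ (f := fun t _ => ‖Θ (P₂ t) t (u t)‖ₑ) s hs)
    have h := hc.pathDist_le_of_forall_norm_le le_rfl ht.1 (h₁ t ht) (h₂ t ht)
      fun s hs => hD s ⟨hs.1, hs.2.trans ht.2⟩
    have he : Real.exp (-lam * (t - 0)) * R₀ ≤ R₀ := by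
      refine mul_le_of_le_one_left hR₀' (Real.exp_le_one_iff.2 ?_)
      nlinarith [ht.1]
    have hS0 : 0 ≤ S.toReal := ENNReal.toReal_nonneg
    conv_rhs => rw [← ENNReal.ofReal_toReal hST]
    rw [← ENNReal.ofReal_mul (by positivity), ← ENNReal.ofReal_add (by positivity) (by positivity)]
    refine ENNReal.ofReal_le_ofReal (hout.trans ?_)
    calc _ ≤ η₁ / √m * (R₀ + 1 / lam * S.toReal) + η₂ / √m * S.toReal := by
          gcongr
          · exact h.trans (add_le_add_left he _)
          · exact hD t ht
      _ = _ := by ring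

end IsContracting

end OutputStability

/-! ### Assembly of the four claims -/

theorem mainTheorem5 (n : ℕ)
    (f : EuclideanSpace ℝ (Fin n) → ℝ → EuclideanSpace ℝ (Fin n))
    (Θ : EuclideanSpace ℝ (Fin n) → ℝ →
      EuclideanSpace ℝ (Fin n) →L[ℝ] EuclideanSpace ℝ (Fin n))
    (lam m : ℝ) (hcontr : IsContracting f Θ lam m) :
    -- bounds for a trajectory `P₁` of the contracting system and a trajectory `P₂` of the
    -- perturbed system
    (∀ (d : EuclideanSpace ℝ (Fin n) → ℝ → EuclideanSpace ℝ (Fin n))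
        (P₁ P₂ : ℝ → EuclideanSpace ℝ (Fin n)),
      IsTrajectory f 0 P₁ → IsTrajectory (fun x t => f x t + d x t) 0 P₂ →
      ∀ (R : ℝ → ℝ) (Θd : ℝ → EuclideanSpace ℝ (Fin n)),
      (∀ t, R t = pathDist (fun x => Θ x t) (P₁ t) (P₂ t)) →
      (∀ t, Θd t = Θ (P₂ t) t (d (P₂ t) t)) →
      -- the basic estimate
      (∀ t, 0 ≤ t →
        IntervalIntegrable (fun τ => Real.exp (-lam * (t - τ)) * ‖Θd τ‖) volume 0 t ∧
        R t ≤ Real.exp (-lam * t) * R 0 +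
          ∫ τ in (0 : ℝ)..t, Real.exp (-lam * (t - τ)) * ‖Θd τ‖) ∧
      -- exponential convergence to the error ball when `Θd ∈ ℒ_∞`
      (∀ D : ℝ, (∀ᵐ t ∂(volume.restrict (Ici (0 : ℝ))), ‖Θd t‖ ≤ D) →
        (∀ t, 0 ≤ t →
          R t ≤ Real.exp (-lam * t) * R 0 + D * ((1 - Real.exp (-lam * t)) / lam)) ∧
        limsup R atTop ≤ D / lam) ∧
      (BddAbove (range fun q : EuclideanSpace ℝ (Fin n) × Ici (0 : ℝ) =>
          ‖Θ q.1 q.2 (d q.1 q.2)‖) →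
        limsup R atTop ≤
          (⨆ q : EuclideanSpace ℝ (Fin n) × Ici (0 : ℝ), ‖Θ q.1 q.2 (d q.1 q.2)‖) / lam) ∧
      -- finite-gain `ℒ_p` stability for an output `y = h(x, d, t)`
      (∀ (k : ℕ)
          (h : EuclideanSpace ℝ (Fin n) → EuclideanSpace ℝ (Fin n) → ℝ →
            EuclideanSpace ℝ (Fin k))
          (η₁ η₂ : ℝ), 0 ≤ η₁ → 0 ≤ η₂ →
        ∀ Δy : ℝ → ℝ,
        (∀ t, Δy t = euclidPathDist (h (P₁ t) 0 t) (h (P₂ t) (d (P₂ t) t) t)) →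
        (∀ t, 0 ≤ t → Δy t ≤ η₁ * euclidPathDist (P₁ t) (P₂ t) + η₂ * ‖d (P₂ t) t‖) →
        (∀ p : ℝ≥0∞, 1 ≤ p →
          (∀ τ, 0 ≤ τ → MemLp (fun t => d (P₂ t) t) p (volume.restrict (Icc 0 τ))) →
          ∀ τ, 0 ≤ τ →
            MemLp Θd p (volume.restrict (Icc 0 τ)) ∧
            eLpNorm Δy p (volume.restrict (Icc 0 τ)) ≤
              ENNReal.ofReal (η₁ * zetaConst lam p * R 0 / √m) +
                ENNReal.ofReal ((η₁ / lam + η₂) / √m) *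
                  eLpNorm Θd p (volume.restrict (Icc 0 τ)) ∧
            (∀ Mbar : ℝ,
              (∀ x t, 0 ≤ t → ∀ v, inner ℝ v (metricTensor Θ x t v) ≤ Mbar * ‖v‖ ^ 2) →
              eLpNorm Δy p (volume.restrict (Icc 0 τ)) ≤
                ENNReal.ofReal (η₁ * zetaConst lam p * R 0 / √m) +
                  ENNReal.ofReal ((η₁ / lam + η₂) * √Mbar / √m) *
                    eLpNorm (fun t => d (P₂ t) t) p (volume.restrict (Icc 0 τ)))) ∧
        -- the case `p = ∞` with the pointwise instead of the essential supremum
        (∀ τ, 0 ≤ τ →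
          (⨆ t ∈ Icc 0 τ, ‖Δy t‖ₑ) ≤
            ENNReal.ofReal (η₁ * R 0 / √m) +
              ENNReal.ofReal ((η₁ / lam + η₂) / √m) * ⨆ t ∈ Icc 0 τ, ‖Θd t‖ₑ))) ∧
    -- input-to-state stability in the distance of the metric, with input `Θd`
    (∃ β γ, IsClassKL β ∧ IsClassK γ ∧
      ∀ t₀, 0 ≤ t₀ → ∀ P₁, IsTrajectory f t₀ P₁ →
        IsISSAbout f Θ (fun t => pathDist fun x => Θ x t) β γ t₀ P₁) ∧
    -- input-to-state stability in the Euclidean distance, with input `Θd`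
    (∀ t₀, 0 ≤ t₀ → ∀ P₁, IsTrajectory f t₀ P₁ →
      ∃ β γ, IsClassKL β ∧ IsClassK γ ∧ IsISSAbout f Θ (fun _ x y => ‖y - x‖) β γ t₀ P₁) ∧
    -- uniform input-to-state stability in the Euclidean distance, with input `d`, when the metric
    -- is also uniformly bounded above
    (∀ Mbar : ℝ,
      (∀ x t, 0 ≤ t → ∀ v, inner ℝ v (metricTensor Θ x t v) ≤ Mbar * ‖v‖ ^ 2) →
      ∃ β γ, IsClassKL β ∧ IsClassK γ ∧
        ∀ t₀, 0 ≤ t₀ → ∀ P₁, IsTrajectory f t₀ P₁ →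
          IsISSAbout f (fun _ _ => ContinuousLinearMap.id ℝ (EuclideanSpace ℝ (Fin n)))
            (fun _ x y => ‖y - x‖) β γ t₀ P₁) := by
  have hfc := hcontr.contDiffOn_field.continuousOn
  have hΘc := hcontr.contDiffOn_factor.continuousOn
  have hl := hcontr.rate_pos
  have hm := Real.sqrt_pos.2 hcontr.lower_pos
  refine ⟨fun d P₁ P₂ hP₁ hP₂ R Θd hR hΘd => ?_,
    ⟨_, _, (isClassK_const_mul one_pos).isClassKL_exp_mul hl,
      isClassK_const_mul (one_div_pos.2 hl), fun t₀ ht₀ P₁ hP₁ =>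
        hcontr.isISSAbout_pathDist ht₀ hP₁⟩, fun t₀ ht₀ P₁ hP₁ => ?_, fun Mbar hM => ?_⟩
  · obtain rfl : R = fun t => pathDist (fun x => Θ x t) (P₁ t) (P₂ t) := funext hR
    obtain rfl : Θd = fun t => Θ (P₂ t) t (d (P₂ t) t) := funext hΘd
    have h₁ : ∀ t, 0 ≤ t → IsPerturbedArc f 0 0 t P₁ := fun t ht =>
      hP₁.isPerturbedArc hfc le_rfl ht
    have h₂ : ∀ t, 0 ≤ t → IsPerturbedArc f (fun t => d (P₂ t) t) 0 t P₂ := fun t ht =>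
      hP₂.isPerturbedArc_add hfc le_rfl ht
    have hΘP : ∀ t, 0 ≤ t → ContinuousOn (fun t => Θ (P₂ t) t) (Icc 0 t) := fun t ht =>
      continuousOn_comp_curve hΘc (Icc_subset_Ici_zero t le_rfl) (h₂ t ht).continuousOn
    have hball : ∀ D : ℝ, (∀ᵐ t ∂(volume.restrict (Ici (0 : ℝ))),
        ‖Θ (P₂ t) t (d (P₂ t) t)‖ ≤ D) →
        (∀ t, 0 ≤ t → pathDist (fun x => Θ x t) (P₁ t) (P₂ t) ≤
          Real.exp (-lam * t) * pathDist (fun x => Θ x 0) (P₁ 0) (P₂ 0) +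
            D * ((1 - Real.exp (-lam * t)) / lam)) ∧
        limsup (fun t => pathDist (fun x => Θ x t) (P₁ t) (P₂ t)) atTop ≤ D / lam :=
      fun D hD => by
        have hb : ∀ t, 0 ≤ t → pathDist (fun x => Θ x t) (P₁ t) (P₂ t) ≤
            Real.exp (-lam * t) * pathDist (fun x => Θ x 0) (P₁ 0) (P₂ 0) +
            D * ((1 - Real.exp (-lam * t)) / lam) := fun t ht => by
          have h := hcontr.pathDist_le_of_ae_norm_le le_rfl ht (h₁ t ht) (h₂ t ht)
            (ae_restrict_of_ae_restrict_of_subset Icc_subset_Ici_self hD)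
          rwa [sub_zero] at h
        refine ⟨hb, limsup_le_of_eventually_le_of_tendsto (fun t => pathDist_nonneg _ _ _)
          ((eventually_ge_atTop 0).mono hb) ?_⟩
        have he : Tendsto (fun t : ℝ => Real.exp (-lam * t)) atTop (𝓝 0) :=
          Real.tendsto_exp_atBot.comp (tendsto_id.const_mul_atTop_of_neg (neg_lt_zero.2 hl))
        have h := (he.mul_const (pathDist (fun x => Θ x 0) (P₁ 0) (P₂ 0))).add
          (((he.const_sub 1).div_const lam).const_mul D)
        simpa [div_eq_mul_inv] using h
    refine ⟨fun t ht => ⟨?_, ?_⟩, hball, fun hbdd => (hball _ ?_).2,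
      fun k h η₁ η₂ hη₁ hη₂ Δy hΔy hΔ => ?_⟩
    · exact ((h₂ t ht).intervalIntegrable.clm_apply_continuousOn ht
        (hΘP t ht)).norm.continuousOn_mul (by fun_prop)
    · have h := hcontr.pathDist_le le_rfl ht (h₁ t ht) (h₂ t ht)
      rwa [sub_zero] at h
    · filter_upwards [ae_restrict_mem measurableSet_Ici] with t ht
      exact le_ciSup hbdd (P₂ t, ⟨t, ht⟩)
    · have hΔ₀ : ∀ t, 0 ≤ Δy t := fun t => by rw [hΔy]; exact pathDist_nonneg _ _ _
      refine ⟨fun p hp hd τ hτ => ?_, fun τ hτ => hcontr.iSup_output_le hη₁ hη₂ hΔ₀ hΔ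
        (fun t ht => h₁ t ht.1) (fun t ht => h₂ t ht.1)⟩
      have hmem := (hd τ hτ).clm_apply_continuousOn (hΘP τ hτ)
      have hmain := hcontr.eLpNorm_output_le hη₁ hη₂ hΔ₀ hΔ hτ (fun t ht => h₁ t ht.1)
        (fun t ht => h₂ t ht.1) hp hmem
      refine ⟨hmem, hmain, fun Mbar hM => hmain.trans (add_le_add_right ?_ _)⟩
      have hle : eLpNorm (fun t => Θ (P₂ t) t (d (P₂ t) t)) p (volume.restrict (Icc 0 τ)) ≤
          ENNReal.ofReal √Mbar *
            eLpNorm (fun t => d (P₂ t) t) p (volume.restrict (Icc 0 τ)) := by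
        refine eLpNorm_le_mul_eLpNorm_of_ae_le_mul ?_ p
        filter_upwards [ae_restrict_mem measurableSet_Icc] with t ht
        exact norm_le_sqrt_mul_of_metricTensor_le hM _ _ ht.1 _
      refine (mul_le_mul_right hle _).trans (le_of_eq ?_)
      rw [← mul_assoc, ← ENNReal.ofReal_mul (by positivity)]
      congr 2; ring
  -- With no upper bound on `M`, the comparison function comes from the size of `Θ` near `P₁ t₀`,
  -- hence the dependence on `t₀` and `P₁`.
  · obtain ⟨α, hα, hle⟩ := exists_isClassK_pathDist_le
      (continuous_slice hcontr.contDiffOn_factor ht₀) (P₁ t₀)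
    have hα' : IsClassK fun r => α r / √m :=
      { continuousOn := hα.continuousOn.div_const _
        strictMonoOn := fun a ha b hb hab => div_lt_div_of_pos_right (hα.strictMonoOn ha hb hab) hm
        map_zero := by simp [hα.map_zero] }
    refine ⟨_, _, hα'.isClassKL_exp_mul hl, isClassK_const_mul (c := 1 / (lam * √m))
      (by positivity), hcontr.isISSAbout_norm ht₀ hP₁ (fun x => ?_) zero_le_one
        fun x t _ v => (one_mul _).ge⟩
    rw [mul_div_cancel₀ _ hm.ne']
    exact hle x
  -- `√Mbar` may be 0, for example when `n = 0`; adding 1 keeps the linear comparison functions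
  -- strictly increasing.
  · have hκ : 0 < √Mbar + 1 := by positivity
    have hΘ : ∀ x t, 0 ≤ t → ∀ v, ‖Θ x t v‖ ≤ (√Mbar + 1) * ‖v‖ := fun x t ht v =>
      (norm_le_sqrt_mul_of_metricTensor_le hM x t ht v).trans (by gcongr; linarith)
    refine ⟨_, _, (isClassK_const_mul (c := (√Mbar + 1) / √m) (by positivity)).isClassKL_exp_mul hl,
      isClassK_const_mul (c := (√Mbar + 1) / (lam * √m)) (by positivity),
      fun t₀ ht₀ P₁ hP₁ => hcontr.isISSAbout_norm ht₀ hP₁ (fun x => ?_) hκ.le hΘ⟩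
    rw [div_mul_eq_mul_div, mul_div_cancel₀ _ hm.ne']
    exact pathDist_le_of_segment _ _ _ fun s _ => hΘ _ _ ht₀ _
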